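/- Let $\tau = 35/18$. For an integer $d\ge 2$ the Wave Soliton distribution on $\{1,\dots,d\}$ is given by $p_1=\tau/d$, $p_2=\tau/70$ and $p_k=\tau/(k(k-1))$ for $3\le k\le d$. Let $m,n\ge 1$ be integers with $mn\ge 2$, and let $G=G(V_1,V_2,P)$ be the random bipartite graph with $|V_1|=|V_2|=mn$ in which each vertex of $V_2$, independently of the others, draws a degree $k$ from the Wave Soliton distribution on $\{1,\dots,mn\}$ and is then joined to a uniformly random set of $k$ vertices of $V_1$. Given a finite set $S\subset\mathbb{R}$ with $|S|=(mn)^2$, let the coefficient matrix $M$ be the $mn\times mn$ matrix, with rows indexed by $V_2$ and columns by $V_1$, whose entry at $(v,u)$ is $0$ if $u$ and $v$ are not joined in $G$ and is $x_{vu}$ otherwise, where the $x_{vu}$ are independent, uniformly distributed on $S$, and independent of $G$. Then there is an absolute constant $c>0$ such that, for all such $m$, $n$ and $S$, $$\mathbb{P}(G\text{ contains a perfect matching})>1-c\,(mn)^{-0.94},$$ and $$\mathbb{P}(M\text{ has full rank } mn)>1-c\,(mn)^{-0.94}.$$ -/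

import Mathlib

open MeasureTheory ProbabilityTheory

noncomputable section

namespace SparseCode

/-- The normalizing factor `τ = 35 / 18`. -/
def tau : ℝ := 35 / 18

/-- The Wave Soliton probabilities with maximal degree `d`:
`p₁ = τ / d`, `p₂ = τ / 70`, `pₖ = τ / (k (k - 1))` for `3 ≤ k ≤ d`, and `pₖ = 0` otherwise. -/
def waveSolitonWeight (d k : ℕ) : ℝ :=
  if k = 1 then tau / d
  else if k = 2 then tau / 70
  else if 3 ≤ k ∧ k ≤ d then tau / ((k : ℝ) * ((k : ℝ) - 1))
  else 0

theorem waveSolitonWeight_nonneg (d k : ℕ) : 0 ≤ waveSolitonWeight d k := by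
  unfold waveSolitonWeight tau
  split_ifs with h1 h2 h3
  · positivity
  · positivity
  · have h : (3 : ℝ) ≤ k := by exact_mod_cast h3.1
    have h' : (0 : ℝ) ≤ (k : ℝ) - 1 := by linarith
    positivity
  · exact le_rfl

theorem waveSolitonWeight_partial_sum (d e : ℕ) (he : e + 2 ≤ d) :
    ∑ k ∈ Finset.range (e + 3), waveSolitonWeight d k
      = tau / d + tau / 70 + tau * (1 / 2 - 1 / ((e : ℝ) + 2)) := by
  induction e with
  | zero => norm_num [Finset.sum_range_succ, waveSolitonWeight]
  | succ e ih =>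
    rw [show e + 1 + 3 = (e + 3) + 1 by ring, Finset.sum_range_succ, ih (by omega)]
    unfold waveSolitonWeight
    rw [if_neg (by omega), if_neg (by omega), if_pos (by omega)]
    have : (e : ℝ) + 2 ≠ 0 := by positivity
    have : (e : ℝ) + 3 ≠ 0 := by positivity
    push_cast
    rw [show (e : ℝ) + 3 - 1 = e + 2 by ring, show (e : ℝ) + 1 + 2 = e + 3 by ring]
    field_simp
    ring

theorem waveSolitonWeight_sum (d : ℕ) (hd : 2 ≤ d) :
    ∑ k : Fin (d + 1), waveSolitonWeight d k = 1 := by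
  obtain ⟨e, rfl⟩ := Nat.exists_eq_add_of_le' hd
  rw [Fin.sum_univ_eq_sum_range (fun k => waveSolitonWeight (e + 2) k) (e + 2 + 1)]
  rw [waveSolitonWeight_partial_sum (e + 2) e le_rfl]
  have : (e : ℝ) + 2 ≠ 0 := by positivity
  unfold tau
  push_cast
  field_simp
  ring

/-- The Wave Soliton distribution on the degrees `0, 1, …, d` (degree `0` has probability `0`).
For `d = 1` the defining weights do not sum to `1`. -/
def waveSoliton (d : ℕ) (hd : 2 ≤ d) : PMF (Fin (d + 1)) :=
  PMF.ofFintype (fun k => ENNReal.ofReal (waveSolitonWeight d k)) (by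
    rw [← ENNReal.ofReal_sum_of_nonneg
        fun (k : Fin (d + 1)) _ => waveSolitonWeight_nonneg d (k : ℕ),
      waveSolitonWeight_sum d hd, ENNReal.ofReal_one])

/-- The law of the neighbourhood in `V₁ = Fin d` of one vertex of `V₂`: a degree `k` is drawn
from `P`, then a uniformly random `k`-element subset of `V₁` is drawn. -/
def neighbourhoodLaw (d : ℕ) (P : PMF (Fin (d + 1))) : PMF (Finset (Fin d)) :=
  P.bind fun k => PMF.uniformOfFinset ((Finset.univ : Finset (Fin d)).powersetCard k)
    (Finset.powersetCard_nonempty.2 (by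
      rw [Finset.card_univ, Fintype.card_fin]
      exact Nat.le_of_lt_succ k.isLt))

/-- The random balanced bipartite graph `G(V₁, V₂, P)` with `V₁ = V₂ = Fin d`, given by the family
of the neighbourhoods in `V₁` of the vertices of `V₂`, which are independent and follow
`neighbourhoodLaw d P`. -/
def randomNeighbourhoods (d : ℕ) (P : PMF (Fin (d + 1))) : Measure (Fin d → Finset (Fin d)) :=
  Measure.pi fun _ => (neighbourhoodLaw d P).toMeasure

/-- The bipartite graph in which `v ∈ V₂` is joined to exactly the vertices of `N v ⊆ V₁`. -/
def bipartiteGraph {V₁ V₂ : Type*} (N : V₂ → Finset V₁) : SimpleGraph (V₁ ⊕ V₂) where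
  Adj a b := (∃ u v, u ∈ N v ∧ a = Sum.inl u ∧ b = Sum.inr v) ∨
    (∃ u v, u ∈ N v ∧ a = Sum.inr v ∧ b = Sum.inl u)
  symm := ⟨by
    rintro a b (⟨u, v, h, ha, hb⟩ | ⟨u, v, h, ha, hb⟩)
    · exact Or.inr ⟨u, v, h, hb, ha⟩
    · exact Or.inl ⟨u, v, h, hb, ha⟩⟩
  loopless := ⟨by
    rintro a (⟨u, v, _, rfl, h⟩ | ⟨u, v, _, rfl, h⟩) <;> cases h⟩

/-- The coefficient matrix of the bipartite graph with neighbourhoods `N` and edge values `x`: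
rows are indexed by `V₂` (the workers), columns by `V₁` (the blocks), and the entry `(v, u)` is
`x (v, u)` if `u` and `v` are joined and `0` otherwise. -/
def coefficientMatrix {d : ℕ} (N : Fin d → Finset (Fin d)) (x : Fin d × Fin d → ℝ) :
    Matrix (Fin d) (Fin d) ℝ :=
  Matrix.of fun v u => if u ∈ N v then x (v, u) else 0

/-- The joint law of the random graph `G(V₁, V₂, P)` and of the edge values: the edge values are
independent, uniform on the finite set `S`, and independent of the graph. -/
def randomCoefficients (d : ℕ) (P : PMF (Fin (d + 1))) (S : Finset ℝ) :
    Measure ((Fin d → Finset (Fin d)) × (Fin d × Fin d → ℝ)) :=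
  (randomNeighbourhoods d P).prod (Measure.pi fun _ => uniformOn (S : Set ℝ))

end SparseCode

end

/-!
The graph has no perfect matching only if some `A ⊆ V₁` violates Hall's condition. A violator of least
cardinality `s` has exactly `s - 1` neighbours in `V₂`, each with at least two neighbours in `A`
(`exists_minimal_hall_violator`). Put `d = m n`, `b = d - s`, `β = b / d`, `γ = s / d`. As the
neighbourhoods are independent, the failure probability is at most
`∑ s, (d choose s) (d choose (s - 1)) q ^ (b + 1) r ^ (s - 1)`
(`randomNeighbourhoods_real_no_matching_le`), where `q` and `r` bound the probabilities that a random
neighbourhood avoids `A`, respectively meets it at least twice. Here `q ≤ (τ / d) β + β² X` for an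
explicit polynomial `X = avoidanceFactor d β ≤ 1`, and the degree-one part costs only the factor
`e ^ 140`. A union bound over pairs for degrees up to a cut-off `K`, which may depend on `γ`, gives
`r ≤ (1/36 + (K - 2) 35/36) γ² + τ / K`. Since `(d choose s) β ^ b γ ^ s ≤ 1`, a term is at most
`e ^ 140 X ^ b (r / γ²) ^ s β γ / r` (`union_bound_term_le`). Up to the factor `e ^ 140`, it is estimated
according to the density of the violator:

* `γ ≤ 1/25`: with `K ≈ 3 / (2 γ)` and the closed form of the series extending `X`, which contains
  `γ log γ`, the term is at
  most `(A γ ^ (τ - 1)) ^ s` for a constant `A`. The sum is dominated by `s = 1`, the isolated vertices,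
  and is `O(d ^ (-17/18))`; this is the main contribution, and `17/18 > 0.94`.
* `β ≤ 1/5`: with `r = 1` the term is at most `(b / d) (e² X) ^ b` and `e² X < 4/5`, so the sum is
  `O(1 / d)`.
* otherwise: the exponent `β log X + γ log (r / γ²)` is bounded, by linearizing the logarithms, by a
  function convex in `β`, so that on each of six intervals it is enough to look at the endpoints; the
  terms are `O(e ^ (-d / 250))`.

If the graph has a perfect matching, the determinant of the coefficient matrix is a nonzero polynomial of
degree at most `d` in the edge values, so by Schwartz–Zippel the matrix is singular with
probability at most `d / d² = 1 / d`.
-/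

/-! ### Hall's condition and minimal violators -/

/-- If the bipartite graph with neighbourhoods `N v ⊆ V₁` has no system of distinct representatives
`f : V₁ → V₂`, a violator `A` of Hall's condition of least cardinality has exactly `#A - 1`
neighbours, and each of them has at least two neighbours in `A`: otherwise removing a vertex of `A`
would leave a smaller violator. -/
theorem exists_minimal_hall_violator {V₁ V₂ : Type*} [Fintype V₁] [Fintype V₂] [DecidableEq V₁]
    [DecidableEq V₂] (N : V₂ → Finset V₁)
    (h : ¬ ∃ f : V₁ → V₂, Function.Injective f ∧ ∀ u, u ∈ N (f u)) :
    ∃ (A : Finset V₁) (B : Finset V₂), B.card + 1 = A.card ∧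
      (∀ v, v ∉ B → Disjoint (N v) A) ∧ ∀ v ∈ B, 2 ≤ (N v ∩ A).card := by
  classical
  let t : V₁ → Finset V₂ := fun u => Finset.univ.filter fun v => u ∈ N v
  have ht : ¬ ∀ A : Finset V₁, A.card ≤ (A.biUnion t).card := by
    intro hA
    obtain ⟨f, hf, hft⟩ := (Finset.all_card_le_biUnion_card_iff_exists_injective t).1 hA
    exact h ⟨f, hf, fun u => by simpa [t] using hft u⟩
  push Not at ht
  obtain ⟨A, hA, hmin⟩ := (Finset.univ.filter fun A : Finset V₁ =>
    (A.biUnion t).card < A.card).exists_min_image Finset.card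
      (by obtain ⟨A, hA⟩ := ht; exact ⟨A, by simpa using hA⟩)
  simp only [Finset.mem_filter, Finset.mem_univ, true_and] at hA hmin
  have hsub : ∀ u ∈ A, A.card ≤ ((A.erase u).biUnion t).card + 1 := by
    intro u hu
    by_contra hlt
    have hc := Finset.card_erase_of_mem hu
    have := hmin (A.erase u) (by omega)
    omega
  have hmono : ∀ u, (A.erase u).biUnion t ⊆ A.biUnion t := fun u =>
    Finset.biUnion_subset_biUnion_of_subset_left _ (Finset.erase_subset _ _)
  have hmem : ∀ v (C : Finset V₁), v ∈ C.biUnion t ↔ ∃ u ∈ C, u ∈ N v := by simp [t]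
  refine ⟨A, A.biUnion t, ?_, fun v hv => ?_, fun v hv => ?_⟩
  · obtain ⟨u, hu⟩ := Finset.card_pos.1 (by omega : 0 < A.card)
    have := Finset.card_le_card (hmono u)
    have := hsub u hu
    omega
  · rw [Finset.disjoint_left]
    intro u hu huA
    exact hv ((hmem v A).2 ⟨u, huA, hu⟩)
  · by_contra hlt
    obtain ⟨u, huA, huN⟩ := (hmem v A).1 hv
    have huniq : ∀ w ∈ A, w ∈ N v → w = u := fun w hw hwN =>
      Finset.card_le_one.1 (by omega : (N v ∩ A).card ≤ 1) w (Finset.mem_inter.2 ⟨hwN, hw⟩) u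
        (Finset.mem_inter.2 ⟨huN, huA⟩)
    have hss : (A.erase u).biUnion t ⊂ A.biUnion t := by
      refine Finset.ssubset_iff_subset_ne.2 ⟨hmono u, fun he => ?_⟩
      obtain ⟨w, hw, hwN⟩ := (hmem v (A.erase u)).1 (he ▸ hv)
      exact Finset.ne_of_mem_erase hw (huniq w (Finset.mem_of_mem_erase hw) hwN)
    have := Finset.card_lt_card hss
    have := hsub u huA
    omega

/-- A bijection along edges gives a perfect matching. -/
theorem bipartiteGraph_exists_isPerfectMatching {V₁ V₂ : Type*} (N : V₂ → Finset V₁) {f : V₁ → V₂}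
    (hf : Function.Bijective f) (hN : ∀ u, u ∈ N (f u)) :
    ∃ M : (SparseCode.bipartiteGraph N).Subgraph, M.IsPerfectMatching := by
  let M : (SparseCode.bipartiteGraph N).Subgraph :=
    { verts := Set.univ
      Adj := fun a b => ∃ u, (a = Sum.inl u ∧ b = Sum.inr (f u)) ∨ (a = Sum.inr (f u) ∧ b = Sum.inl u)
      adj_sub := by
        rintro a b ⟨u, ⟨rfl, rfl⟩ | ⟨rfl, rfl⟩⟩
        · exact Or.inl ⟨u, f u, hN u, rfl, rfl⟩
        · exact Or.inr ⟨u, f u, hN u, rfl, rfl⟩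
      edge_vert := fun _ => Set.mem_univ _
      symm := ⟨by
        rintro a b ⟨u, h | h⟩
        · exact ⟨u, Or.inr ⟨h.2, h.1⟩⟩
        · exact ⟨u, Or.inl ⟨h.2, h.1⟩⟩⟩ }
  refine ⟨M, SimpleGraph.Subgraph.isPerfectMatching_iff.2 ?_⟩
  rintro (u | v)
  · refine ⟨Sum.inr (f u), ⟨u, Or.inl ⟨rfl, rfl⟩⟩, ?_⟩
    rintro b ⟨w, ⟨h, rfl⟩ | ⟨h, rfl⟩⟩
    · rw [Sum.inl.inj h]
    · cases h
  · obtain ⟨u, rfl⟩ := hf.2 v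
    refine ⟨Sum.inl u, ⟨u, Or.inr ⟨rfl, rfl⟩⟩, ?_⟩
    rintro b ⟨w, ⟨h, rfl⟩ | ⟨h, rfl⟩⟩
    · cases h
    · rw [hf.1 (Sum.inr.inj h)]

/-! ### The Schwartz–Zippel bound for the coefficient matrix -/

/-- The zero set of a nonzero polynomial under independent uniform variables. -/
theorem pi_uniformOn_real_eval_eq_zero_le {σ : Type*} [Fintype σ] {p : MvPolynomial σ ℝ}
    (hp : p ≠ 0) {S : Finset ℝ} (hS : S.Nonempty) :
    (Measure.pi fun _ : σ => uniformOn (S : Set ℝ)).real {x | MvPolynomial.eval x p = 0} ≤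
      p.totalDegree / S.card := by
  classical
  have hS' : (S : Set ℝ).Nonempty := hS
  have : IsProbabilityMeasure (uniformOn (S : Set ℝ)) :=
    isProbabilityMeasure_uniformOn S.finite_toSet hS'
  set ν := Measure.pi fun _ : σ => uniformOn (S : Set ℝ) with hν
  have hSc : (0 : ℝ) < S.card := by exact_mod_cast hS.card_pos
  let F : Finset (σ → ℝ) := (Fintype.piFinset fun _ => S).filter fun x => MvPolynomial.eval x p = 0
  have hpt : ∀ x ∈ Fintype.piFinset fun _ : σ => S,
      ν.real {x} = ((S.card : ℝ) ^ Fintype.card σ)⁻¹ := by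
    intro x hx
    rw [Fintype.mem_piFinset] at hx
    rw [measureReal_def, hν, ← Set.univ_pi_singleton, Measure.pi_pi, ENNReal.toReal_prod]
    rw [Finset.prod_congr rfl (g := fun _ => (S.card : ℝ)⁻¹), Finset.prod_const, Finset.card_univ,
      inv_pow]
    intro i _
    rw [← Finset.coe_singleton, uniformOn_apply_finset]
    simp [Finset.inter_singleton_of_mem (hx i)]
  have hfull : ν.real (Set.univ.pi fun _ => (S : Set ℝ)) = 1 := by
    rw [measureReal_def, hν, Measure.pi_pi]
    simp [uniformOn_self S.finite_toSet hS']
  have hcompl : ν.real (Set.univ.pi fun _ => (S : Set ℝ))ᶜ = 0 := by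
    rw [measureReal_compl (MeasurableSet.univ_pi fun _ => S.measurableSet), hfull]
    simp
  have hcount : (F.card : ℝ) / (S.card : ℝ) ^ Fintype.card σ ≤ p.totalDegree / S.card := by
    let e := Fintype.equivFin σ
    have hp' : MvPolynomial.rename e p ≠ 0 := fun h0 =>
      hp (MvPolynomial.rename_injective e e.injective (by simpa using h0))
    have hsz := MvPolynomial.schwartz_zippel_totalDegree hp' S
    have hcard : (Finset.filter (fun f => MvPolynomial.eval f (MvPolynomial.rename e p) = 0)
        (Fintype.piFinset fun _ : Fin (Fintype.card σ) => S)).card = F.card := by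
      refine Finset.card_bij (fun f _ => f ∘ e) ?_ ?_ ?_
      · intro f hf
        simp only [Finset.mem_filter, Fintype.mem_piFinset, F, MvPolynomial.eval_rename] at hf ⊢
        exact ⟨fun i => hf.1 _, hf.2⟩
      · intro f _ g _ hfg
        exact e.surjective.injective_comp_right hfg
      · intro x hx
        simp only [Finset.mem_filter, Fintype.mem_piFinset, F] at hx
        refine ⟨x ∘ e.symm, ?_, by ext; simp⟩
        simp only [Finset.mem_filter, Fintype.mem_piFinset, MvPolynomial.eval_rename]
        refine ⟨fun i => hx.1 _, ?_⟩
        rw [Function.comp_assoc, e.symm_comp_self, Function.comp_id]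
        exact hx.2
    rw [hcard] at hsz
    have hdeg : (MvPolynomial.rename e p).totalDegree ≤ p.totalDegree :=
      MvPolynomial.totalDegree_rename_le _ _
    have hsz' : (F.card : ℝ) / (S.card : ℝ) ^ Fintype.card σ ≤
        (MvPolynomial.rename e p).totalDegree / S.card := by
      have := (NNRat.cast_le (K := ℝ)).2 hsz
      push_cast at this
      exact this
    refine hsz'.trans ?_
    gcongr
  calc ν.real {x | MvPolynomial.eval x p = 0}
      ≤ ν.real ((F : Set (σ → ℝ)) ∪ (Set.univ.pi fun _ => (S : Set ℝ))ᶜ) := by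
        refine measureReal_mono fun x hx => ?_
        by_cases hxS : x ∈ Set.univ.pi fun _ => (S : Set ℝ)
        · left
          simp only [F, Finset.coe_filter, Fintype.mem_piFinset, Set.mem_ofPred_eq]
          exact ⟨fun i => hxS i trivial, hx⟩
        · exact Or.inr hxS
    _ ≤ ν.real (F : Set (σ → ℝ)) + ν.real (Set.univ.pi fun _ => (S : Set ℝ))ᶜ :=
        measureReal_union_le _ _
    _ = ∑ x ∈ F, ν.real {x} := by
        rw [hcompl, add_zero, sum_measureReal_singleton]
    _ = F.card / (S.card : ℝ) ^ Fintype.card σ := by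
        rw [Finset.sum_congr rfl fun x hx => hpt x (Finset.mem_filter.1 hx).1]
        rw [Finset.sum_const, nsmul_eq_mul, div_eq_mul_inv]
    _ ≤ _ := hcount

/-- The coefficient matrix with indeterminate edge values. -/
noncomputable def genericCoefficientMatrix {d : ℕ} (N : Fin d → Finset (Fin d)) :
    Matrix (Fin d) (Fin d) (MvPolynomial (Fin d × Fin d) ℝ) :=
  Matrix.of fun v u => if u ∈ N v then MvPolynomial.X (v, u) else 0

theorem eval_det_genericCoefficientMatrix {d : ℕ} (N : Fin d → Finset (Fin d))
    (x : Fin d × Fin d → ℝ) :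
    MvPolynomial.eval x (genericCoefficientMatrix N).det =
      (SparseCode.coefficientMatrix N x).det := by
  rw [RingHom.map_det]
  congr 1
  ext v u
  simp only [RingHom.mapMatrix_apply, Matrix.map_apply, genericCoefficientMatrix,
    SparseCode.coefficientMatrix, Matrix.of_apply]
  split_ifs <;> simp

theorem totalDegree_det_genericCoefficientMatrix_le {d : ℕ} (N : Fin d → Finset (Fin d)) :
    (genericCoefficientMatrix N).det.totalDegree ≤ d := by
  rw [Matrix.det_apply]
  refine MvPolynomial.totalDegree_finsetSum_le fun σ _ => ?_
  refine (MvPolynomial.totalDegree_smul_le _ _).trans ?_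
  refine (MvPolynomial.totalDegree_finsetProd _ _).trans ?_
  refine (Finset.sum_le_card_nsmul _ _ 1 fun i _ => ?_).trans (by simp)
  simp only [genericCoefficientMatrix, Matrix.of_apply]
  split_ifs <;> simp

theorem det_genericCoefficientMatrix_ne_zero {d : ℕ} (N : Fin d → Finset (Fin d))
    (f : Equiv.Perm (Fin d)) (hN : ∀ u, u ∈ N (f u)) : (genericCoefficientMatrix N).det ≠ 0 := by
  intro h0
  -- At the indicator of the matching, the coefficient matrix is a permutation matrix.
  have h := eval_det_genericCoefficientMatrix N fun vu => if f vu.2 = vu.1 then 1 else 0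
  have hM : SparseCode.coefficientMatrix N (fun vu => if f vu.2 = vu.1 then (1 : ℝ) else 0) =
      Equiv.Perm.permMatrix ℝ f⁻¹ := by
    ext v u
    simp only [SparseCode.coefficientMatrix, Matrix.of_apply, Equiv.Perm.permMatrix,
      PEquiv.toMatrix_apply, Equiv.toPEquiv_apply, Option.mem_def, Option.some.injEq]
    by_cases hvu : f u = v
    · subst hvu
      simp [hN u]
    · have : (Equiv.symm f) v ≠ u := fun hu => hvu (by rw [← hu]; simp)
      simp [hvu, this]
  rw [h0, hM, Matrix.det_permutation] at h
  rcases Int.units_eq_one_or (Equiv.Perm.sign f⁻¹) with h1 | h1 <;> simp [h1] at h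

/-- Schwartz–Zippel: along a perfect matching, singular edge values have probability at most
`d / #S`. -/
theorem pi_uniformOn_real_rank_ne_le {d : ℕ} (N : Fin d → Finset (Fin d))
    (f : Equiv.Perm (Fin d)) (hN : ∀ u, u ∈ N (f u)) {S : Finset ℝ} (hS : S.Nonempty) :
    (Measure.pi fun _ : Fin d × Fin d => uniformOn (S : Set ℝ)).real
      {x | (SparseCode.coefficientMatrix N x).rank ≠ d} ≤ d / S.card := by
  have hS' : (S : Set ℝ).Nonempty := hS
  have : IsProbabilityMeasure (uniformOn (S : Set ℝ)) :=
    isProbabilityMeasure_uniformOn S.finite_toSet hS'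
  refine (measureReal_mono (fun x hx => ?_)).trans
    ((pi_uniformOn_real_eval_eq_zero_le (det_genericCoefficientMatrix_ne_zero N f hN) hS).trans ?_)
  · rw [Set.mem_ofPred_eq, eval_det_genericCoefficientMatrix]
    by_contra hdet
    refine hx ?_
    rw [Matrix.rank_of_isUnit _ ((Matrix.isUnit_iff_isUnit_det _).2 (isUnit_iff_ne_zero.2 hdet)),
      Fintype.card_fin]
  · gcongr
    exact totalDegree_det_genericCoefficientMatrix_le N

/-! ### The law of one neighbourhood -/

theorem waveSoliton_apply_toReal {d : ℕ} (hd : 2 ≤ d) (k : Fin (d + 1)) :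
    (SparseCode.waveSoliton d hd k).toReal = SparseCode.waveSolitonWeight d k := by
  simp [SparseCode.waveSoliton, PMF.ofFintype_apply,
    ENNReal.toReal_ofReal (SparseCode.waveSolitonWeight_nonneg d k)]

theorem neighbourhoodLaw_real {d : ℕ} (P : PMF (Fin (d + 1))) (p : Finset (Fin d) → Prop)
    [DecidablePred p] :
    (SparseCode.neighbourhoodLaw d P).toMeasure.real {N | p N} =
      ∑ k : Fin (d + 1), (P k).toReal *
        ((((Finset.univ : Finset (Fin d)).powersetCard k).filter p).card / (d.choose k : ℝ)) := by
  rw [measureReal_def, SparseCode.neighbourhoodLaw,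
    PMF.toMeasure_bind_apply _ _ _ (DiscreteMeasurableSpace.forall_measurableSet _),
    tsum_fintype, ENNReal.toReal_sum]
  · refine Finset.sum_congr rfl fun k _ => ?_
    rw [ENNReal.toReal_mul, PMF.toMeasure_uniformOfFinset_apply _ _
      (DiscreteMeasurableSpace.forall_measurableSet _)]
    simp [ENNReal.toReal_div]
  · intro k _
    exact ENNReal.mul_ne_top (PMF.apply_ne_top _ _) (measure_ne_top _ _)

theorem sum_waveSolitonWeight_mul {d : ℕ} (hd : 2 ≤ d) (f : ℕ → ℝ) :
    ∑ k : Fin (d + 1), SparseCode.waveSolitonWeight d k * f k =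
      35 / 18 / d * f 1 + 1 / 36 * f 2 +
        ∑ k ∈ Finset.Icc 3 d, 35 / 18 / ((k : ℝ) * ((k : ℝ) - 1)) * f k := by
  rw [Fin.sum_univ_eq_sum_range (fun k => SparseCode.waveSolitonWeight d k * f k) (d + 1),
    Finset.range_eq_Ico, Finset.sum_eq_sum_Ico_succ_bot (by omega),
    Finset.sum_eq_sum_Ico_succ_bot (by omega), Finset.sum_eq_sum_Ico_succ_bot (by omega)]
  have h : Finset.Ico (0 + 1 + 1 + 1) (d + 1) = Finset.Icc 3 d := by ext; simp
  rw [h]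
  have h' : ∀ k ∈ Finset.Icc 3 d, SparseCode.waveSolitonWeight d k * f k =
      35 / 18 / ((k : ℝ) * ((k : ℝ) - 1)) * f k := by
    intro k hk
    rw [Finset.mem_Icc] at hk
    rw [SparseCode.waveSolitonWeight, if_neg (by omega), if_neg (by omega), if_pos hk,
      SparseCode.tau]
  rw [Finset.sum_congr rfl h']
  norm_num [SparseCode.waveSolitonWeight, SparseCode.tau]
  ring

theorem choose_mul_pow_le_choose_mul_pow {b d : ℕ} (h : b ≤ d) (k : ℕ) :
    b.choose k * d ^ k ≤ d.choose k * b ^ k := by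
  have key : b.descFactorial k * d ^ k ≤ d.descFactorial k * b ^ k := by
    induction k with
    | zero => simp
    | succ k ih =>
      rw [Nat.descFactorial_succ, Nat.descFactorial_succ, pow_succ, pow_succ]
      have h1 : (b - k) * d ≤ (d - k) * b := by
        rw [Nat.sub_mul, Nat.sub_mul, Nat.mul_comm b d]
        exact Nat.sub_le_sub_left (Nat.mul_le_mul_left k h) _
      calc (b - k) * b.descFactorial k * (d ^ k * d)
          = ((b - k) * d) * (b.descFactorial k * d ^ k) := by ring
        _ ≤ ((d - k) * b) * (d.descFactorial k * b ^ k) := Nat.mul_le_mul h1 ih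
        _ = _ := by ring
  rw [Nat.descFactorial_eq_factorial_mul_choose, Nat.descFactorial_eq_factorial_mul_choose,
    mul_assoc, mul_assoc] at key
  exact Nat.le_of_mul_le_mul_left key k.factorial_pos

theorem choose_div_choose_le_pow {b d : ℕ} (hd : 0 < d) (h : b ≤ d) {k : ℕ} (hk : k ≤ d) :
    (b.choose k : ℝ) / d.choose k ≤ ((b : ℝ) / d) ^ k := by
  have hc : (0 : ℝ) < d.choose k := by exact_mod_cast Nat.choose_pos hk
  have hd' : (0 : ℝ) < d := by exact_mod_cast hd
  rw [div_pow, div_le_div_iff₀ hc (by positivity)]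
  have := choose_mul_pow_le_choose_mul_pow h k
  rw [mul_comm ((b : ℝ) ^ k)]
  exact_mod_cast this

theorem card_powersetCard_filter_disjoint {d : ℕ} (A : Finset (Fin d)) (k : ℕ) :
    (((Finset.univ : Finset (Fin d)).powersetCard k).filter fun N => Disjoint N A).card =
      (d - A.card).choose k := by
  have : ((Finset.univ : Finset (Fin d)).powersetCard k).filter (fun N => Disjoint N A) =
      Aᶜ.powersetCard k := by
    ext N
    simp only [Finset.mem_filter, Finset.mem_powersetCard, Finset.subset_univ, true_and]
    rw [Finset.disjoint_right, Finset.subset_iff]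
    simp only [Finset.mem_compl]
    exact ⟨fun h => ⟨fun x hx hA => h.2 hA hx, h.1⟩, fun h => ⟨h.2, fun x hA hx => h.1 hx hA⟩⟩
  rw [this, Finset.card_powersetCard, Finset.card_compl, Fintype.card_fin]

/-- The union bound over pairs: at most `(#A choose 2) (d - 2 choose k - 2)` of the `k`-subsets meet
`A` twice. -/
theorem card_powersetCard_filter_two_le {d : ℕ} (A : Finset (Fin d)) (k : ℕ) :
    (((Finset.univ : Finset (Fin d)).powersetCard k).filter fun N => 2 ≤ (N ∩ A).card).card ≤
      A.card.choose 2 * (d - 2).choose (k - 2) := by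
  calc _ ≤ ((A.powersetCard 2).biUnion fun Q =>
        (Qᶜ.powersetCard (k - 2)).image fun R => Q ∪ R).card := by
        refine Finset.card_le_card fun N hN => ?_
        simp only [Finset.mem_filter, Finset.mem_powersetCard, Finset.subset_univ, true_and] at hN
        obtain ⟨Q, hQ, hQc⟩ := Finset.exists_subset_card_eq hN.2
        have hQN : Q ⊆ N := hQ.trans Finset.inter_subset_left
        refine Finset.mem_biUnion.2 ⟨Q, Finset.mem_powersetCard.2
          ⟨hQ.trans Finset.inter_subset_right, hQc⟩, Finset.mem_image.2 ⟨N \ Q, ?_, ?_⟩⟩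
        · rw [Finset.mem_powersetCard, Finset.card_sdiff_of_subset hQN, hN.1, hQc]
          refine ⟨fun x hx => ?_, rfl⟩
          simpa using (Finset.mem_sdiff.1 hx).2
        · exact Finset.union_sdiff_of_subset hQN
    _ ≤ ∑ Q ∈ A.powersetCard 2, ((Qᶜ.powersetCard (k - 2)).image fun R => Q ∪ R).card :=
        Finset.card_biUnion_le
    _ ≤ ∑ Q ∈ A.powersetCard 2, (d - 2).choose (k - 2) := by
        refine Finset.sum_le_sum fun Q hQ => Finset.card_image_le.trans ?_
        rw [Finset.card_powersetCard, Finset.card_compl, Fintype.card_fin,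
          (Finset.mem_powersetCard.1 hQ).2]
    _ = _ := by simp

theorem card_filter_two_div_choose_le {d : ℕ} (A : Finset (Fin d)) {k : ℕ} (hk : 2 ≤ k)
    (hkd : k ≤ d) :
    ((((Finset.univ : Finset (Fin d)).powersetCard k).filter fun N => 2 ≤ (N ∩ A).card).card : ℝ) /
      d.choose k ≤ (k : ℝ) * (k - 1) / 2 * ((A.card : ℝ) / d) ^ 2 := by
  have hc : (0 : ℝ) < d.choose k := by exact_mod_cast Nat.choose_pos hkd
  have hd' : (0 : ℝ) < d := by exact_mod_cast (by omega : 0 < d)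
  have hd2 : (2 : ℝ) ≤ d := by exact_mod_cast (by omega : 2 ≤ d)
  have h1 : ((((Finset.univ : Finset (Fin d)).powersetCard k).filter
      fun N => 2 ≤ (N ∩ A).card).card : ℝ) ≤ A.card.choose 2 * (d - 2).choose (k - 2) := by
    exact_mod_cast card_powersetCard_filter_two_le A k
  have h2 : (d.choose k : ℝ) * k.choose 2 = d.choose 2 * (d - 2).choose (k - 2) := by
    exact_mod_cast Nat.choose_mul (n := d) hk
  rw [Nat.cast_choose_two, Nat.cast_choose_two] at h2
  rw [Nat.cast_choose_two] at h1
  have hA : (A.card : ℝ) ≤ d := by exact_mod_cast (by simpa using A.card_le_univ)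
  have hA0 : (0 : ℝ) ≤ A.card := Nat.cast_nonneg _
  have h3 : (A.card : ℝ) * (A.card - 1) / 2 ≤ (A.card / d) ^ 2 * (d * (d - 1) / 2) := by
    rw [div_pow, div_mul_eq_mul_div, le_div_iff₀ (by positivity)]
    nlinarith [mul_nonneg hA0 (mul_nonneg hd'.le (sub_nonneg.2 hA))]
  rw [div_le_iff₀ hc]
  refine h1.trans ((mul_le_mul_of_nonneg_right h3 (Nat.cast_nonneg _)).trans (le_of_eq ?_))
  rw [mul_assoc, ← h2]
  ring

theorem sum_Ioc_inv_mul_pred_le {K : ℕ} (hK : 1 ≤ K) (d : ℕ) :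
    ∑ k ∈ Finset.Ioc K d, 1 / ((k : ℝ) * ((k : ℝ) - 1)) ≤ 1 / K := by
  have hK' : (0 : ℝ) < K := by exact_mod_cast hK
  rcases le_or_gt d K with h | h
  · rw [Finset.Ioc_eq_empty (by omega)]
    simp
  · have key : ∀ e, ∑ k ∈ Finset.Ioc K (K + e), 1 / ((k : ℝ) * ((k : ℝ) - 1)) =
        1 / K - 1 / ((K : ℝ) + e) := by
      intro e
      induction e with
      | zero => simp
      | succ e ih =>
        rw [← add_assoc, Finset.sum_Ioc_succ_top (by omega), ih]
        have : (K : ℝ) + e ≠ 0 := by positivity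
        have : (K : ℝ) + e + 1 ≠ 0 := by positivity
        push_cast
        rw [add_sub_cancel_right, ← add_assoc]
        field_simp
        ring
    obtain ⟨e, rfl⟩ := Nat.exists_eq_add_of_lt h
    rw [add_assoc, key]
    have : (0 : ℝ) ≤ 1 / ((K : ℝ) + (e + 1 : ℕ)) := by positivity
    linarith

theorem sum_Icc_le_add_sum_Ioc {f : ℕ → ℝ} (a K d : ℕ) (hf : ∀ k, a ≤ k → 0 ≤ f k)
    (haK : a ≤ K + 1) :
    ∑ k ∈ Finset.Icc a d, f k ≤ ∑ k ∈ Finset.Icc a K, f k + ∑ k ∈ Finset.Ioc K d, f k := by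
  rw [← Finset.sum_union]
  · refine Finset.sum_le_sum_of_subset_of_nonneg (fun k => ?_) fun k hk _ => hf k ?_
    · simp only [Finset.mem_union, Finset.mem_Icc, Finset.mem_Ioc]
      omega
    · simp only [Finset.mem_union, Finset.mem_Icc, Finset.mem_Ioc] at hk
      omega
  · rw [Finset.disjoint_left]
    intro k
    simp only [Finset.mem_Icc, Finset.mem_Ioc]
    omega

/-- An upper bound for the part of `P(N ∩ A = ∅) / β²` that comes from degrees at least two, where
`1 - β` is the density of `A`: the exact value for neighbours drawn with replacement. -/
noncomputable def avoidanceFactor (d : ℕ) (β : ℝ) : ℝ :=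
  1 / 36 + ∑ k ∈ Finset.Icc 3 d, 35 / 18 / ((k : ℝ) * ((k : ℝ) - 1)) * β ^ (k - 2)

theorem waveSoliton_coeff_nonneg {k : ℕ} (hk : 2 ≤ k) :
    (0 : ℝ) ≤ 35 / 18 / ((k : ℝ) * ((k : ℝ) - 1)) := by
  have : (2 : ℝ) ≤ k := by exact_mod_cast hk
  have : (0 : ℝ) ≤ (k : ℝ) - 1 := by linarith
  positivity

theorem le_avoidanceFactor (d : ℕ) {β : ℝ} (hβ : 0 ≤ β) : 1 / 36 ≤ avoidanceFactor d β := by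
  unfold avoidanceFactor
  have : 0 ≤ ∑ k ∈ Finset.Icc 3 d, 35 / 18 / ((k : ℝ) * ((k : ℝ) - 1)) * β ^ (k - 2) :=
    Finset.sum_nonneg fun k hk =>
      mul_nonneg (waveSoliton_coeff_nonneg (by rw [Finset.mem_Icc] at hk; omega)) (by positivity)
  linarith

theorem avoidanceFactor_mono (d : ℕ) {β β' : ℝ} (hβ : 0 ≤ β) (h : β ≤ β') :
    avoidanceFactor d β ≤ avoidanceFactor d β' := by
  unfold avoidanceFactor
  have := Finset.sum_le_sum fun (k : ℕ) (hk : k ∈ Finset.Icc 3 d) =>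
    mul_le_mul_of_nonneg_left (pow_le_pow_left₀ hβ h (k - 2))
      (waveSoliton_coeff_nonneg (k := k) (by rw [Finset.mem_Icc] at hk; omega))
  linarith

theorem avoidanceFactor_le_truncation (d : ℕ) {K : ℕ} (hK : 2 ≤ K) {β : ℝ} (hβ : 0 ≤ β)
    (hβ1 : β ≤ 1) :
    avoidanceFactor d β ≤ 1 / 36 +
      ∑ k ∈ Finset.Icc 3 K, 35 / 18 / ((k : ℝ) * ((k : ℝ) - 1)) * β ^ (k - 2) +
        35 / 18 * β ^ (K - 1) / K := by
  have hsplit := sum_Icc_le_add_sum_Ioc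
    (f := fun k : ℕ => 35 / 18 / ((k : ℝ) * ((k : ℝ) - 1)) * β ^ (k - 2)) 3 K d
    (fun k hk => mul_nonneg (waveSoliton_coeff_nonneg (by omega)) (by positivity)) (by omega)
  have htail : ∑ k ∈ Finset.Ioc K d, 35 / 18 / ((k : ℝ) * ((k : ℝ) - 1)) * β ^ (k - 2) ≤
      35 / 18 * β ^ (K - 1) * (1 / K) := by
    refine le_trans ?_ (mul_le_mul_of_nonneg_left (sum_Ioc_inv_mul_pred_le (by omega) d)
      (by positivity))
    rw [Finset.mul_sum]
    refine Finset.sum_le_sum fun k hk => ?_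
    rw [Finset.mem_Ioc] at hk
    have hp : β ^ (k - 2) ≤ β ^ (K - 1) := pow_le_pow_of_le_one hβ hβ1 (by omega)
    have := mul_le_mul_of_nonneg_left hp (waveSoliton_coeff_nonneg (k := k) (by omega))
    refine this.trans (le_of_eq (by ring))
  unfold avoidanceFactor
  rw [mul_one_div] at htail
  linarith

/-- The sum of the Wave Soliton weights from degree two on is at most one. -/
theorem avoidanceFactor_le_one (d : ℕ) {β : ℝ} (hβ : 0 ≤ β) (hβ1 : β ≤ 1) :
    avoidanceFactor d β ≤ 1 := by
  refine (avoidanceFactor_mono d hβ hβ1).trans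
    ((avoidanceFactor_le_truncation d (le_refl 2) zero_le_one le_rfl).trans (le_of_eq ?_))
  norm_num

theorem neighbourhoodLaw_real_disjoint_le {d : ℕ} (hd : 2 ≤ d) (A : Finset (Fin d)) (b : ℕ)
    (hb : A.card + b = d) :
    (SparseCode.neighbourhoodLaw d (SparseCode.waveSoliton d hd)).toMeasure.real
      {N | Disjoint N A} ≤
        35 / 18 / d * ((b : ℝ) / d) + ((b : ℝ) / d) ^ 2 * avoidanceFactor d (b / d) := by
  rw [neighbourhoodLaw_real]
  have hle : ∀ k : Fin (d + 1), (SparseCode.waveSoliton d hd k).toReal *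
      ((((Finset.univ : Finset (Fin d)).powersetCard k).filter fun N => Disjoint N A).card /
        (d.choose k : ℝ)) ≤ SparseCode.waveSolitonWeight d k * ((b : ℝ) / d) ^ (k : ℕ) := by
    intro k
    rw [waveSoliton_apply_toReal, card_powersetCard_filter_disjoint,
      show d - A.card = b by omega]
    exact mul_le_mul_of_nonneg_left (choose_div_choose_le_pow (by omega) (by omega) (by omega))
      (SparseCode.waveSolitonWeight_nonneg _ _)
  refine (Finset.sum_le_sum fun k _ => hle k).trans (le_of_eq ?_)
  rw [sum_waveSolitonWeight_mul hd fun k => ((b : ℝ) / d) ^ k, avoidanceFactor, mul_add,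
    Finset.mul_sum, pow_one, ← add_assoc]
  congr 1
  · ring
  · refine Finset.sum_congr rfl fun k hk => ?_
    rw [Finset.mem_Icc] at hk
    obtain ⟨j, rfl⟩ := Nat.exists_eq_add_of_le' (by omega : 2 ≤ k)
    rw [Nat.add_sub_cancel, pow_add]
    ring

/-- Degrees up to `K` are treated by the union bound over pairs, larger degrees trivially. -/
theorem neighbourhoodLaw_real_two_le {d : ℕ} (hd : 2 ≤ d) (A : Finset (Fin d)) {K : ℕ}
    (hK : 2 ≤ K) :
    (SparseCode.neighbourhoodLaw d (SparseCode.waveSoliton d hd)).toMeasure.real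
      {N | 2 ≤ (N ∩ A).card} ≤
        (1 / 36 + ((K : ℝ) - 2) * (35 / 36)) * ((A.card : ℝ) / d) ^ 2 + 35 / 18 / K := by
  rw [neighbourhoodLaw_real]
  set γ : ℝ := (A.card : ℝ) / d with hγ
  let m : ℕ → ℝ := fun k => min 1 ((k : ℝ) * (k - 1) / 2 * γ ^ 2)
  have hle : ∀ k : Fin (d + 1), (SparseCode.waveSoliton d hd k).toReal *
      ((((Finset.univ : Finset (Fin d)).powersetCard k).filter fun N => 2 ≤ (N ∩ A).card).card /
        (d.choose k : ℝ)) ≤ SparseCode.waveSolitonWeight d k * m k := by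
    intro k
    rw [waveSoliton_apply_toReal]
    refine mul_le_mul_of_nonneg_left (le_min ?_ ?_) (SparseCode.waveSolitonWeight_nonneg _ _)
    · refine div_le_one_of_le₀ ?_ (Nat.cast_nonneg _)
      have := Finset.card_filter_le ((Finset.univ : Finset (Fin d)).powersetCard k)
        fun N => 2 ≤ (N ∩ A).card
      rw [Finset.card_powersetCard, Finset.card_univ, Fintype.card_fin] at this
      exact_mod_cast this
    · rcases le_or_gt 2 (k : ℕ) with hk | hk
      · exact card_filter_two_div_choose_le A hk (by omega)
      · have h0 : (((Finset.univ : Finset (Fin d)).powersetCard k).filter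
            fun N => 2 ≤ (N ∩ A).card) = ∅ := by
          rw [Finset.filter_eq_empty_iff]
          intro N hN h2
          have := Finset.card_le_card (Finset.inter_subset_left : N ∩ A ⊆ N)
          have := (Finset.mem_powersetCard.1 hN).2
          omega
        rw [h0]
        have : (k : ℕ) = 0 ∨ (k : ℕ) = 1 := by omega
        rcases this with h | h <;> simp [h]
  refine (Finset.sum_le_sum fun k _ => hle k).trans ?_
  rw [sum_waveSolitonWeight_mul hd m]
  have hm0 : ∀ k, 2 ≤ k → 0 ≤ m k := fun k hk => by
    have : (2 : ℝ) ≤ k := by exact_mod_cast hk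
    have : (0 : ℝ) ≤ (k : ℝ) - 1 := by linarith
    exact le_min zero_le_one (by positivity)
  have hsplit := sum_Icc_le_add_sum_Ioc
    (f := fun k : ℕ => 35 / 18 / ((k : ℝ) * ((k : ℝ) - 1)) * m k) 3 K d
    (fun k hk => mul_nonneg (waveSoliton_coeff_nonneg (by omega)) (hm0 k (by omega))) (by omega)
  have hhead : ∑ k ∈ Finset.Icc 3 K, 35 / 18 / ((k : ℝ) * ((k : ℝ) - 1)) * m k ≤
      ((K : ℝ) - 2) * (35 / 36) * γ ^ 2 := by
    have : ∀ k ∈ Finset.Icc 3 K, 35 / 18 / ((k : ℝ) * ((k : ℝ) - 1)) * m k ≤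
        35 / 36 * γ ^ 2 := by
      intro k hk
      rw [Finset.mem_Icc] at hk
      refine (mul_le_mul_of_nonneg_left (min_le_right _ _) (waveSoliton_coeff_nonneg (by omega))).trans
        (le_of_eq ?_)
      have h3 : (3 : ℝ) ≤ k := by exact_mod_cast hk.1
      have : (k : ℝ) ≠ 0 := by positivity
      have : (k : ℝ) - 1 ≠ 0 := by linarith
      field_simp
      ring
    refine (Finset.sum_le_sum this).trans (le_of_eq ?_)
    rw [Finset.sum_const, Nat.card_Icc, nsmul_eq_mul,
      show K + 1 - 3 = K - 2 by omega, Nat.cast_sub hK]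
    push_cast
    ring
  have htail : ∑ k ∈ Finset.Ioc K d, 35 / 18 / ((k : ℝ) * ((k : ℝ) - 1)) * m k ≤ 35 / 18 / K := by
    have h1 := mul_le_mul_of_nonneg_left (sum_Ioc_inv_mul_pred_le (by omega : 1 ≤ K) d)
      (by norm_num : (0 : ℝ) ≤ 35 / 18)
    rw [Finset.mul_sum, mul_one_div] at h1
    refine le_trans (Finset.sum_le_sum fun k hk => ?_) h1
    rw [Finset.mem_Ioc] at hk
    refine (mul_le_mul_of_nonneg_left (min_le_left _ _) (waveSoliton_coeff_nonneg (by omega))).trans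
      (le_of_eq (by ring))
  have hm1 : m 1 = 0 := by simp [m]
  have hm2 : m 2 ≤ γ ^ 2 := (min_le_right _ _).trans (le_of_eq (by norm_num))
  rw [hm1]
  linarith

/-! ### The union bound over minimal violators -/

theorem randomNeighbourhoods_real_no_matching_le {d : ℕ} (P : PMF (Fin (d + 1))) {q r : ℕ → ℝ}
    (hq : ∀ A : Finset (Fin d), A.Nonempty →
      (SparseCode.neighbourhoodLaw d P).toMeasure.real {N | Disjoint N A} ≤ q A.card)
    (hr : ∀ A : Finset (Fin d), A.Nonempty →
      (SparseCode.neighbourhoodLaw d P).toMeasure.real {N | 2 ≤ (N ∩ A).card} ≤ r A.card) :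
    (SparseCode.randomNeighbourhoods d P).real
      {N | ¬ ∃ f : Fin d → Fin d, Function.Injective f ∧ ∀ u, u ∈ N (f u)} ≤
        ∑ s ∈ Finset.Icc 1 d,
          (d.choose s : ℝ) * d.choose (s - 1) * q s ^ (d - s + 1) * r s ^ (s - 1) := by
  have : IsProbabilityMeasure (SparseCode.randomNeighbourhoods d P) := by
    unfold SparseCode.randomNeighbourhoods
    infer_instance
  let E : Finset (Fin d) → Finset (Fin d) → Set (Fin d → Finset (Fin d)) := fun A B =>
    Set.univ.pi fun v => if v ∈ B then {N | 2 ≤ (N ∩ A).card} else {N | Disjoint N A}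
  have hE : ∀ s ∈ Finset.Icc 1 d, ∀ A ∈ (Finset.univ : Finset (Fin d)).powersetCard s,
      ∀ B ∈ (Finset.univ : Finset (Fin d)).powersetCard (s - 1),
      (SparseCode.randomNeighbourhoods d P).real (E A B) ≤ q s ^ (d - s + 1) * r s ^ (s - 1) := by
    intro s hs A hA B hB
    rw [Finset.mem_Icc] at hs
    obtain rfl := (Finset.mem_powersetCard.1 hA).2
    have hne : A.Nonempty := Finset.card_pos.1 (by omega)
    have hBc := (Finset.mem_powersetCard.1 hB).2
    rw [measureReal_def, SparseCode.randomNeighbourhoods, Measure.pi_pi, ENNReal.toReal_prod]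
    refine (Finset.prod_le_prod (fun _ _ => ENNReal.toReal_nonneg)
      (g := fun v => if v ∈ B then r A.card else q A.card) fun v _ => ?_).trans (le_of_eq ?_)
    · split_ifs
      · exact hr A hne
      · exact hq A hne
    · rw [Finset.prod_ite, Finset.prod_const, Finset.prod_const, mul_comm]
      have h1 : (Finset.univ.filter fun v => v ∈ B) = B := by ext; simp
      have h2 : (Finset.univ.filter fun v => v ∉ B) = Bᶜ := by ext; simp
      rw [h1, h2, Finset.card_compl, Fintype.card_fin, hBc,
        show d - (A.card - 1) = d - A.card + 1 by omega]
  calc _ ≤ (SparseCode.randomNeighbourhoods d P).real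
        (⋃ s ∈ Finset.Icc 1 d, ⋃ A ∈ (Finset.univ : Finset (Fin d)).powersetCard s,
          ⋃ B ∈ (Finset.univ : Finset (Fin d)).powersetCard (s - 1), E A B) := by
        refine measureReal_mono (fun N hN => ?_) (measure_ne_top _ _)
        obtain ⟨A, B, hc, h0, h2⟩ := exists_minimal_hall_violator N hN
        have hA : A.card ≤ d := by simpa using A.card_le_univ
        simp only [Set.mem_iUnion, Finset.mem_Icc, Finset.mem_powersetCard, Finset.subset_univ,
          true_and, exists_prop]
        refine ⟨A.card, ⟨by omega, hA⟩, A, rfl, B, by omega, fun v _ => ?_⟩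
        by_cases hv : v ∈ B
        · simpa [hv] using h2 v hv
        · simpa [hv] using h0 v hv
    _ ≤ ∑ s ∈ Finset.Icc 1 d, ∑ _A ∈ (Finset.univ : Finset (Fin d)).powersetCard s,
          ∑ _B ∈ (Finset.univ : Finset (Fin d)).powersetCard (s - 1),
            q s ^ (d - s + 1) * r s ^ (s - 1) := by
        refine (measureReal_biUnion_finset_le _ _).trans (Finset.sum_le_sum fun s hs => ?_)
        refine (measureReal_biUnion_finset_le _ _).trans (Finset.sum_le_sum fun A hA => ?_)
        exact (measureReal_biUnion_finset_le _ _).trans (Finset.sum_le_sum fun B hB =>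
          hE s hs A hA B hB)
    _ = _ := by
        refine Finset.sum_congr rfl fun s _ => ?_
        simp only [Finset.sum_const, Finset.card_powersetCard, Finset.card_univ, Fintype.card_fin,
          nsmul_eq_mul]
        ring

/-! ### Bounding one term of the union bound -/

theorem choose_mul_pow_mul_pow_le_one {x y : ℝ} (hx : 0 ≤ x) (hy : 0 ≤ y) (hxy : x + y = 1)
    (b s : ℕ) : ((b + s).choose s : ℝ) * x ^ b * y ^ s ≤ 1 := by
  have h := add_pow x y (b + s)
  rw [hxy, one_pow] at h
  rw [h]
  refine le_trans (le_of_eq ?_) (Finset.single_le_sum (f := fun m => x ^ m * y ^ (b + s - m) *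
    ((b + s).choose m : ℝ)) (fun m _ => by positivity)
    (Finset.mem_range.2 (by omega : b < b + s + 1)))
  simp only [Nat.add_sub_cancel_left]
  rw [Nat.choose_symm_add]
  ring

theorem density_add_eq_one {b s : ℕ} (hs : 1 ≤ s) {β γ : ℝ} (hβ : β = b / (b + s : ℕ))
    (hγ : γ = s / (b + s : ℕ)) : β + γ = 1 := by
  have hd : (0 : ℝ) < (b + s : ℕ) := by exact_mod_cast (by omega : 0 < b + s)
  rw [hβ, hγ, ← add_div]
  push_cast at hd ⊢
  exact div_self hd.ne'

/-- The binomial coefficients are absorbed by `(d choose s) β ^ b γ ^ s ≤ 1`, used twice. -/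
theorem choose_mul_choose_mul_le {b s : ℕ} (hb : 1 ≤ b) (hs : 1 ≤ s) {X r β γ : ℝ}
    (hX0 : 0 ≤ X) (hX1 : X ≤ 1) (hr : 0 < r) (hβ : β = b / (b + s : ℕ)) (hγ : γ = s / (b + s : ℕ)) :
    ((b + s).choose s : ℝ) * (b + s).choose (s - 1) * (β ^ 2 * X) ^ (b + 1) * r ^ (s - 1) ≤
      X ^ b * (r / γ ^ 2) ^ s * (β * γ / r) := by
  have hb' : (0 : ℝ) < b := by exact_mod_cast hb
  have hs' : (0 : ℝ) < s := by exact_mod_cast hs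
  have hd : (0 : ℝ) < (b + s : ℕ) := by exact_mod_cast (by omega : 0 < b + s)
  have hβ0 : 0 < β := by rw [hβ]; positivity
  have hγ0 : 0 < γ := by rw [hγ]; positivity
  have hsum := density_add_eq_one hs hβ hγ
  have hC := choose_mul_pow_mul_pow_le_one hβ0.le hγ0.le hsum b s
  have hch : ((b + s).choose (s - 1) : ℝ) = (b + s).choose s * s / (b + 1) := by
    rw [eq_div_iff (by positivity)]
    have := Nat.choose_succ_right_eq (b + s) (s - 1)
    rw [Nat.sub_add_cancel hs, show b + s - (s - 1) = b + 1 by omega] at this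
    exact_mod_cast this.symm
  have hsb : (s : ℝ) / (b + 1) * β ≤ γ := by
    rw [div_mul_eq_mul_div, div_le_iff₀ (by positivity), hβ, hγ, mul_div_assoc',
      div_mul_eq_mul_div]
    gcongr
    linarith
  obtain ⟨j, rfl⟩ := Nat.exists_eq_add_of_le' hs
  rw [Nat.add_sub_cancel] at *
  rw [hch]
  set C : ℝ := ((b + (j + 1)).choose (j + 1) : ℝ)
  have hC0 : 0 ≤ C := Nat.cast_nonneg _
  calc C * (C * (j + 1 : ℕ) / (b + 1)) * (β ^ 2 * X) ^ (b + 1) * r ^ j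
      = (C * β ^ b * γ ^ (j + 1)) ^ 2 * (((j + 1 : ℕ) : ℝ) / (b + 1) * β) * X *
          (X ^ b * (r / γ ^ 2) ^ (j + 1) * (β / r)) := by
        rw [div_pow, ← pow_mul]
        field_simp
        ring
    _ ≤ 1 * γ * 1 * (X ^ b * (r / γ ^ 2) ^ (j + 1) * (β / r)) := by
        have hC2 : (C * β ^ b * γ ^ (j + 1)) ^ 2 ≤ 1 := pow_le_one₀ (by positivity) hC
        gcongr
    _ = _ := by ring

/-- The degree-one part of the avoidance probability costs at most the constant `e ^ 140`. -/
theorem avoidance_pow_le {b d : ℕ} (hb : 1 ≤ b) (hd : b ≤ d) :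
    (35 / 18 / d * ((b : ℝ) / d) + ((b : ℝ) / d) ^ 2 * avoidanceFactor d (b / d)) ^ (b + 1) ≤
      Real.exp 140 * (((b : ℝ) / d) ^ 2 * avoidanceFactor d (b / d)) ^ (b + 1) := by
  have hb' : (1 : ℝ) ≤ b := by exact_mod_cast hb
  have hd' : (0 : ℝ) < d := by exact_mod_cast (by omega : 0 < d)
  have hβ : 0 ≤ (b : ℝ) / d := by positivity
  have hX := le_avoidanceFactor d hβ
  set X := avoidanceFactor d (b / d)
  have h1 : 35 / 18 / d * ((b : ℝ) / d) + ((b : ℝ) / d) ^ 2 * X ≤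
      Real.exp (70 / b) * (((b : ℝ) / d) ^ 2 * X) := by
    have h2 : 35 / 18 / d * ((b : ℝ) / d) = 70 / b * (((b : ℝ) / d) ^ 2 * (1 / 36)) := by
      field_simp
      norm_num
    have h3 : 70 / b * (((b : ℝ) / d) ^ 2 * (1 / 36)) ≤ 70 / b * (((b : ℝ) / d) ^ 2 * X) := by
      gcongr
    have h4 : (70 / b + 1) * (((b : ℝ) / d) ^ 2 * X) ≤
        Real.exp (70 / b) * (((b : ℝ) / d) ^ 2 * X) :=
      mul_le_mul_of_nonneg_right (Real.add_one_le_exp _) (by positivity)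
    linarith
  refine (pow_le_pow_left₀ (by positivity) h1 _).trans ?_
  rw [mul_pow, ← Real.exp_nat_mul]
  gcongr
  push_cast
  rw [mul_div_assoc', div_le_iff₀ (by positivity)]
  linarith

/-- The term of the union bound for violators of size `s = d - b`, estimated by any bound `r` on the
probability that a neighbourhood meets the violator twice. -/
theorem union_bound_term_le {b s : ℕ} (hb : 1 ≤ b) (hs : 1 ≤ s) {r r' β γ : ℝ} (hr' : 0 ≤ r')
    (hrr : r' ≤ r) (hr : 0 < r) (hβ : β = b / (b + s : ℕ)) (hγ : γ = s / (b + s : ℕ)) :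
    ((b + s).choose s : ℝ) * (b + s).choose (s - 1) *
      (35 / 18 / (b + s : ℕ) * β + β ^ 2 * avoidanceFactor (b + s) β) ^ (b + 1) * r' ^ (s - 1) ≤
      Real.exp 140 * (avoidanceFactor (b + s) β ^ b * (r / γ ^ 2) ^ s * (β * γ / r)) := by
  have hβ0 : 0 ≤ β := by rw [hβ]; positivity
  have hd : (0 : ℝ) < (b + s : ℕ) := by exact_mod_cast (by omega : 0 < b + s)
  have hβ1 : β ≤ 1 := by
    rw [hβ, div_le_one hd]
    exact_mod_cast (by omega : b ≤ b + s)
  have hX0 : 0 ≤ avoidanceFactor (b + s) β := le_trans (by norm_num) (le_avoidanceFactor _ hβ0)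
  have h1 := choose_mul_choose_mul_le hb hs hX0 (avoidanceFactor_le_one _ hβ0 hβ1) hr hβ hγ
  have h2 : (35 / 18 / (b + s : ℕ) * β + β ^ 2 * avoidanceFactor (b + s) β) ^ (b + 1) ≤
      Real.exp 140 * (β ^ 2 * avoidanceFactor (b + s) β) ^ (b + 1) := by
    rw [hβ]
    exact avoidance_pow_le hb (by omega)
  refine le_trans ?_ (mul_le_mul_of_nonneg_left h1 (Real.exp_pos _).le)
  calc _ ≤ ((b + s).choose s : ℝ) * (b + s).choose (s - 1) *
        (Real.exp 140 * (β ^ 2 * avoidanceFactor (b + s) β) ^ (b + 1)) * r ^ (s - 1) := by gcongr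
    _ = _ := by ring

/-! ### Violators of intermediate density -/

/-- A polynomial upper bound for `β * avoidanceFactor d β`, uniform in `d`: the series is truncated
at degree `40`, and the remaining weights are moved to degree `41`. -/
noncomputable def avoidancePolynomial (β : ℝ) : ℝ :=
  1 / 36 * β + ∑ i ∈ Finset.range 38, 35 / 18 / (((i : ℝ) + 3) * ((i : ℝ) + 2)) * β ^ (i + 2) +
    35 / 720 * β ^ 40

theorem mul_avoidanceFactor_le (d : ℕ) {β : ℝ} (hβ : 0 ≤ β) (hβ1 : β ≤ 1) :
    β * avoidanceFactor d β ≤ avoidancePolynomial β := by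
  refine (mul_le_mul_of_nonneg_left
    (avoidanceFactor_le_truncation d (by norm_num : 2 ≤ 40) hβ hβ1) hβ).trans (le_of_eq ?_)
  have hIcc : Finset.Icc 3 40 = Finset.Ico 3 41 := by ext; simp; omega
  rw [hIcc, Finset.sum_Ico_eq_sum_range, avoidancePolynomial, mul_add, mul_add, Finset.mul_sum]
  congr 1
  · congr 1
    · ring
    · refine Finset.sum_congr rfl fun i _ => ?_
      rw [show 3 + i - 2 = i + 1 by omega, pow_succ β (i + 1)]
      push_cast
      rw [show (3 : ℝ) + i - 1 = i + 2 by ring, show (3 : ℝ) + i = i + 3 by ring]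
      ring
  · norm_num
    ring

theorem convexOn_avoidancePolynomial : ConvexOn ℝ (Set.Ici 0) avoidancePolynomial := by
  unfold avoidancePolynomial
  refine ConvexOn.add (ConvexOn.add ?_ ?_) ?_
  · exact (convexOn_id (convex_Ici 0)).smul (by norm_num : (0 : ℝ) ≤ 1 / 36)
  · have : ∀ n : ℕ, ConvexOn ℝ (Set.Ici 0) fun β : ℝ =>
        ∑ i ∈ Finset.range n, 35 / 18 / (((i : ℝ) + 3) * ((i : ℝ) + 2)) * β ^ (i + 2) := by
      intro n
      induction n with
      | zero => simpa using convexOn_const (0 : ℝ) (convex_Ici 0)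
      | succ n ih =>
        simp only [Finset.sum_range_succ]
        exact ih.add ((convexOn_pow (n + 2)).smul
          (by positivity : (0 : ℝ) ≤ 35 / 18 / (((n : ℝ) + 3) * ((n : ℝ) + 2))))
    exact this 38
  · exact (convexOn_pow 40).smul (by norm_num : (0 : ℝ) ≤ 35 / 720)

theorem avoidancePolynomial_le_chord {l u pl pu β : ℝ} (hl : 0 ≤ l) (hlu : l < u)
    (hpl : avoidancePolynomial l ≤ pl) (hpu : avoidancePolynomial u ≤ pu) (h1 : l ≤ β)
    (h2 : β ≤ u) : avoidancePolynomial β ≤ ((u - β) * pl + (β - l) * pu) / (u - l) := by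
  have hul : 0 < u - l := by linarith
  have h := convexOn_avoidancePolynomial.2 (Set.mem_Ici.2 hl) (Set.mem_Ici.2 (hl.trans hlu.le))
    (div_nonneg (sub_nonneg.2 h2) hul.le) (div_nonneg (sub_nonneg.2 h1) hul.le)
    (by field_simp; ring)
  simp only [smul_eq_mul] at h
  have he : (u - β) / (u - l) * l + (β - l) / (u - l) * u = β := by
    field_simp
    ring
  rw [he] at h
  refine h.trans ?_
  rw [add_div, div_mul_eq_mul_div, div_mul_eq_mul_div]
  gcongr

theorem exp_tenth_le : Real.exp (1 / 10) ≤ 1.10518 := by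
  have h := Real.exp_bound' (by norm_num : (0 : ℝ) ≤ 1 / 10) (by norm_num) (n := 5) (by norm_num)
  norm_num [Finset.sum_range_succ, Nat.factorial] at h ⊢
  linarith

theorem exp_neg_tenth_le : Real.exp (-(1 / 10)) ≤ 0.904838 := by
  have h := Real.sum_le_exp_of_nonneg (by norm_num : (0 : ℝ) ≤ 1 / 10) 6
  rw [Real.exp_neg]
  refine inv_le_of_inv_le₀ (by norm_num) (le_trans ?_ h)
  norm_num [Finset.sum_range_succ, Nat.factorial]

/-- Linearization of `X ^ b * Y ^ s`: with `log x ≤ x / x₀ - 1 + log x₀` at `x₀ = e ^ (-i / 10)` for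
`X` and `x₀ = e ^ (j / 10)` for `Y`. The decimals are upper bounds for `e ^ (1 / 10)` and
`e ^ (-1 / 10)`. -/
theorem pow_mul_pow_le_exp {X Y : ℝ} (hX : 0 ≤ X) (hY : 0 ≤ Y) (b s i j : ℕ) :
    X ^ b * Y ^ s ≤ Real.exp (b * (X * 1.10518 ^ i - 1 - i / 10) +
      s * (Y * 0.904838 ^ j - 1 + j / 10)) := by
  have h1 : X ≤ Real.exp (X * 1.10518 ^ i - 1 - i / 10) := by
    have hE : Real.exp (i / 10) ≤ 1.10518 ^ i := by
      rw [show (i : ℝ) / 10 = i * (1 / 10) by ring, Real.exp_nat_mul]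
      exact pow_le_pow_left₀ (Real.exp_pos _).le exp_tenth_le _
    have h2 := Real.add_one_le_exp (X * 1.10518 ^ i - 1)
    rw [Real.exp_sub, le_div_iff₀ (Real.exp_pos _)]
    exact (mul_le_mul_of_nonneg_left hE hX).trans (by linarith)
  have h2 : Y ≤ Real.exp (Y * 0.904838 ^ j - 1 + j / 10) := by
    have hE : Real.exp (-(j / 10)) ≤ 0.904838 ^ j := by
      rw [show -((j : ℝ) / 10) = j * (-(1 / 10)) by ring, Real.exp_nat_mul]
      exact pow_le_pow_left₀ (Real.exp_pos _).le exp_neg_tenth_le _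
    have h2 := Real.add_one_le_exp (Y * 0.904838 ^ j - 1)
    have h3 := (mul_le_mul_of_nonneg_left hE hY).trans (by linarith :
      Y * 0.904838 ^ j ≤ Real.exp (Y * 0.904838 ^ j - 1))
    rw [Real.exp_neg, ← div_eq_mul_inv, div_le_iff₀ (Real.exp_pos _)] at h3
    rwa [Real.exp_add]
  rw [Real.exp_add, Real.exp_nat_mul, Real.exp_nat_mul]
  gcongr

/-- On an interval `[l, u]` of densities `β`, the linearized exponent is convex in `β`, so it is
enough to check its two endpoint values. -/
theorem pow_mul_pow_le_exp_of_endpoints {l u pl pu c e ε : ℝ} (i j : ℕ) (hl : 0 ≤ l) (hlu : l < u)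
    (hu : u < 1) (hc : 0 ≤ c) (he : 0 ≤ e) (hpl : avoidancePolynomial l ≤ pl)
    (hpu : avoidancePolynomial u ≤ pu)
    (hGl : pl * 1.10518 ^ i + (c * (1 - l) + e / (1 - l)) * 0.904838 ^ j - 1 - l * (i / 10) +
      (1 - l) * (j / 10) ≤ -ε)
    (hGu : pu * 1.10518 ^ i + (c * (1 - u) + e / (1 - u)) * 0.904838 ^ j - 1 - u * (i / 10) +
      (1 - u) * (j / 10) ≤ -ε)
    {b s : ℕ} {β γ : ℝ} (hs : 1 ≤ s) (hβ : β = b / (b + s : ℕ)) (hγ : γ = s / (b + s : ℕ))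
    (hlβ : l ≤ β) (hβu : β ≤ u) :
    avoidanceFactor (b + s) β ^ b * ((c * γ ^ 2 + e) / γ ^ 2) ^ s ≤
      Real.exp (-ε * (b + s : ℕ)) := by
  have hd : (0 : ℝ) < (b + s : ℕ) := by exact_mod_cast (by omega : 0 < b + s)
  have hβ0 : 0 ≤ β := hl.trans hlβ
  have hsum := density_add_eq_one hs hβ hγ
  have hγ' : γ = 1 - β := by linarith
  have hγ0 : 0 < γ := by linarith
  have hX0 : 0 ≤ avoidanceFactor (b + s) β := le_trans (by norm_num) (le_avoidanceFactor _ hβ0)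
  have hP := (mul_avoidanceFactor_le (b + s) hβ0 (by linarith)).trans
    (avoidancePolynomial_le_chord hl hlu hpl hpu hlβ hβu)
  set X := avoidanceFactor (b + s) β
  refine (pow_mul_pow_le_exp hX0 (by positivity) b s i j).trans (Real.exp_le_exp.2 ?_)
  have hb : (b : ℝ) = β * (b + s : ℕ) := by rw [hβ]; field_simp
  have hs' : (s : ℝ) = γ * (b + s : ℕ) := by rw [hγ]; field_simp
  set D : ℝ := ((b + s : ℕ) : ℝ)
  have hE0 : (0 : ℝ) ≤ 1.10518 ^ i := by positivity
  have hF0 : (0 : ℝ) ≤ 0.904838 ^ j := by positivity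
  have hul : 0 < u - l := by linarith
  -- The chord bound for `1 / γ` over `[1 - u, 1 - l]`.
  have hinv : 1 / γ ≤ ((u - β) * (1 / (1 - l)) + (β - l) * (1 / (1 - u))) / (u - l) := by
    have h1 : 0 < 1 - l := by linarith
    have h2 : 0 < 1 - u := by linarith
    have h3 : ((u - β) * (1 / (1 - l)) + (β - l) * (1 / (1 - u))) / (u - l) =
        (1 - l + (1 - u) - γ) / ((1 - l) * (1 - u)) := by
      rw [hγ']
      field_simp
      ring
    rw [h3, div_le_div_iff₀ hγ0 (by positivity), hγ']
    nlinarith [mul_nonneg (sub_nonneg.2 hlβ) (sub_nonneg.2 hβu)]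
  set E : ℝ := 1.10518 ^ i
  set F : ℝ := 0.904838 ^ j
  have key : β * X * E + (c * γ + e * (1 / γ)) * F - 1 - β * (i / 10) + γ * (j / 10) ≤ -ε := by
    have hl' := mul_le_mul_of_nonneg_left hGl (div_nonneg (sub_nonneg.2 hβu) hul.le)
    have hu' := mul_le_mul_of_nonneg_left hGu (div_nonneg (sub_nonneg.2 hlβ) hul.le)
    have h1 := mul_le_mul_of_nonneg_right hP hE0
    have h2 := mul_le_mul_of_nonneg_right (mul_le_mul_of_nonneg_left hinv he) hF0
    have hcomb : ((u - β) * pl + (β - l) * pu) / (u - l) * E + (c * γ) * F +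
        e * (((u - β) * (1 / (1 - l)) + (β - l) * (1 / (1 - u))) / (u - l)) * F - 1 -
          β * (i / 10) + γ * (j / 10) =
        (u - β) / (u - l) * (pl * E + (c * (1 - l) + e / (1 - l)) * F - 1 - l * (i / 10) +
          (1 - l) * (j / 10)) +
        (β - l) / (u - l) * (pu * E + (c * (1 - u) + e / (1 - u)) * F - 1 - u * (i / 10) +
          (1 - u) * (j / 10)) := by
      rw [hγ']
      have h1 : 1 - l ≠ 0 := by linarith
      have h2 : 1 - u ≠ 0 := by linarith
      field_simp
      ring
    have hε : (u - β) / (u - l) * -ε + (β - l) / (u - l) * -ε = -ε := by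
      field_simp
      ring
    linarith
  have hY : γ * ((c * γ ^ 2 + e) / γ ^ 2) = c * γ + e * (1 / γ) := by
    field_simp
  calc (b : ℝ) * (X * E - 1 - i / 10) + s * ((c * γ ^ 2 + e) / γ ^ 2 * F - 1 + j / 10)
      = D * (β * X * E + γ * ((c * γ ^ 2 + e) / γ ^ 2) * F - (β + γ) - β * (i / 10) +
          γ * (j / 10)) := by
        rw [hb, hs']
        ring
    _ = D * (β * X * E + (c * γ + e * (1 / γ)) * F - 1 - β * (i / 10) + γ * (j / 10)) := by
        rw [hY, hsum]
    _ ≤ D * -ε := mul_le_mul_of_nonneg_left key hd.le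
    _ = _ := by ring

/-- For each density `β ∈ [1/5, 24/25]` some bound `c γ² + e` on the probability that a neighbourhood
meets a violator of density `γ = 1 - β` twice makes the union bound exponentially small. -/
theorem exists_two_bound_of_intermediate {b s : ℕ} (hs : 1 ≤ s) {β γ : ℝ}
    (hβ : β = b / (b + s : ℕ)) (hγ : γ = s / (b + s : ℕ)) (h1 : 1 / 5 ≤ β) (h2 : β ≤ 24 / 25) :
    ∃ c e : ℝ, 0 ≤ c ∧ 1 / 18 ≤ e ∧ ((c = 0 ∧ e = 1) ∨ ∃ K : ℕ, 2 ≤ K ∧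
      c = 1 / 36 + ((K : ℝ) - 2) * (35 / 36) ∧ e = 35 / 18 / K) ∧
      avoidanceFactor (b + s) β ^ b * ((c * γ ^ 2 + e) / γ ^ 2) ^ s ≤
        Real.exp (-(1 / 250) * (b + s : ℕ)) := by
  have p20 : avoidancePolynomial 0.2 ≤ 0.0199947 := by
    norm_num [avoidancePolynomial, Finset.sum_range_succ]
  have p40 : avoidancePolynomial 0.4 ≤ 0.0767587 := by
    norm_num [avoidancePolynomial, Finset.sum_range_succ]
  have p59 : avoidancePolynomial 0.59 ≤ 0.1824735 := by
    norm_num [avoidancePolynomial, Finset.sum_range_succ]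
  have p75 : avoidancePolynomial 0.75 ≤ 0.3375875 := by
    norm_num [avoidancePolynomial, Finset.sum_range_succ]
  have p87 : avoidancePolynomial 0.87 ≤ 0.5301516 := by
    norm_num [avoidancePolynomial, Finset.sum_range_succ]
  have p95 : avoidancePolynomial 0.95 ≤ 0.745139 := by
    norm_num [avoidancePolynomial, Finset.sum_range_succ]
  have p96 : avoidancePolynomial 0.96 ≤ 0.783459 := by
    norm_num [avoidancePolynomial, Finset.sum_range_succ]
  rcases le_or_gt β 0.4 with h40 | h40
  · exact ⟨0, 1, le_rfl, by norm_num, Or.inl ⟨rfl, rfl⟩,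
      pow_mul_pow_le_exp_of_endpoints 17 8 (by norm_num) (by norm_num) (by norm_num) le_rfl
        (by norm_num) p20 p40 (by norm_num) (by norm_num) hs hβ hγ (by linarith) h40⟩
  rcases le_or_gt β 0.59 with h59 | h59
  · exact ⟨1, 35 / 54, by norm_num, by norm_num, Or.inr ⟨3, by norm_num, by norm_num, by norm_num⟩,
      pow_mul_pow_le_exp_of_endpoints 14 13 (by norm_num) (by norm_num) (by norm_num) (by norm_num)
        (by norm_num) p40 p59 (by norm_num) (by norm_num) hs hβ hγ h40.le h59⟩
  rcases le_or_gt β 0.75 with h75 | h75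
  · exact ⟨71 / 36, 35 / 72, by norm_num, by norm_num,
      Or.inr ⟨4, by norm_num, by norm_num, by norm_num⟩,
      pow_mul_pow_le_exp_of_endpoints 9 19 (by norm_num) (by norm_num) (by norm_num) (by norm_num)
        (by norm_num) p59 p75 (by norm_num) (by norm_num) hs hβ hγ h59.le h75⟩
  rcases le_or_gt β 0.87 with h87 | h87
  · exact ⟨176 / 36, 35 / 126, by norm_num, by norm_num,
      Or.inr ⟨7, by norm_num, by norm_num, by norm_num⟩,
      pow_mul_pow_le_exp_of_endpoints 6 26 (by norm_num) (by norm_num) (by norm_num) (by norm_num)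
        (by norm_num) p75 p87 (by norm_num) (by norm_num) hs hβ hγ h75.le h87⟩
  rcases le_or_gt β 0.95 with h95 | h95
  · exact ⟨491 / 36, 35 / 288, by norm_num, by norm_num,
      Or.inr ⟨16, by norm_num, by norm_num, by norm_num⟩,
      pow_mul_pow_le_exp_of_endpoints 3 35 (by norm_num) (by norm_num) (by norm_num) (by norm_num)
        (by norm_num) p87 p95 (by norm_num) (by norm_num) hs hβ hγ h87.le h95⟩
  · exact ⟨1156 / 36, 1 / 18, by norm_num, by norm_num,
      Or.inr ⟨35, by norm_num, by norm_num, by norm_num⟩,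
      pow_mul_pow_le_exp_of_endpoints 2 35 (by norm_num) (by norm_num) (by norm_num) (by norm_num)
        (by norm_num) p95 p96 (by norm_num) (by norm_num) hs hβ hγ h95.le (by linarith)⟩

/-! ### Violators containing almost all of `V₁` -/

theorem avoidance_pow_le_of_le_fifth {b s : ℕ} (hs : 1 ≤ s) {β γ : ℝ}
    (hβ : β = b / (b + s : ℕ)) (hγ : γ = s / (b + s : ℕ)) (h : β ≤ 1 / 5) :
    avoidanceFactor (b + s) β ^ b * (1 / γ ^ 2) ^ s ≤ (4 / 5) ^ b := by
  have hd : (0 : ℝ) < (b + s : ℕ) := by exact_mod_cast (by omega : 0 < b + s)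
  have hβ0 : 0 ≤ β := by rw [hβ]; positivity
  have hs' : (0 : ℝ) < s := by exact_mod_cast hs
  have hγ0 : 0 < γ := by rw [hγ]; positivity
  have hsum := density_add_eq_one hs hβ hγ
  have hX0 : 0 ≤ avoidanceFactor (b + s) β := le_trans (by norm_num) (le_avoidanceFactor _ hβ0)
  have hX : avoidanceFactor (b + s) β ≤ 0.104 := by
    refine (avoidanceFactor_mono _ hβ0 h).trans ((avoidanceFactor_le_truncation _
      (by norm_num : 2 ≤ 4) (by norm_num) (by norm_num)).trans ?_)
    rw [show Finset.Icc 3 4 = {3, 4} by decide]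
    norm_num
  have hγs : (1 / γ ^ 2) ^ s ≤ Real.exp 2 ^ b := by
    have h1 : 1 / γ ≤ Real.exp (b / s) := by
      refine le_trans (le_of_eq ?_) (Real.add_one_le_exp _)
      rw [hγ, one_div_div]
      push_cast
      field_simp
    calc (1 / γ ^ 2) ^ s = ((1 / γ) ^ 2) ^ s := by rw [div_pow 1 γ 2, one_pow]
      _ ≤ (Real.exp (b / s) ^ 2) ^ s := by gcongr
      _ = Real.exp 2 ^ b := by
        rw [← Real.exp_nat_mul, ← Real.exp_nat_mul, ← Real.exp_nat_mul]
        congr 1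
        push_cast
        field_simp
  have he : Real.exp 2 ≤ 7.4 := by
    rw [show (2 : ℝ) = 1 + 1 by norm_num, Real.exp_add]
    have := Real.exp_one_lt_d9
    have := Real.exp_pos 1
    nlinarith
  calc _ ≤ 0.104 ^ b * Real.exp 2 ^ b := by gcongr
    _ = (0.104 * Real.exp 2) ^ b := by rw [mul_pow]
    _ ≤ (4 / 5) ^ b := by
      gcongr
      linarith

/-! ### Sparse violators -/

theorem hasSum_pow_div_mul {β : ℝ} (hβ0 : 0 ≤ β) (hβ1 : β < 1) :
    HasSum (fun n : ℕ => β ^ (n + 2) / (((n : ℝ) + 2) * ((n : ℝ) + 1)))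
      (β + (1 - β) * Real.log (1 - β)) := by
  have h := Real.hasSum_pow_div_log_of_abs_lt_one (x := β) (by rw [abs_of_nonneg hβ0]; exact hβ1)
  have h2 := (hasSum_nat_add_iff' 1).2 h
  have h3 := (h.mul_left β).sub h2
  have hterm : (fun n : ℕ => β ^ (n + 2) / (((n : ℝ) + 2) * ((n : ℝ) + 1))) =
      fun n : ℕ => β * (β ^ (n + 1) / ((n : ℝ) + 1)) - β ^ (n + 1 + 1) / (((n + 1 : ℕ) : ℝ) + 1) := by
    funext n
    have : (n : ℝ) + 1 ≠ 0 := by positivity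
    have : (n : ℝ) + 2 ≠ 0 := by positivity
    push_cast
    rw [show (n : ℝ) + 1 + 1 = n + 2 by ring]
    field_simp
    ring
  have hval : β + (1 - β) * Real.log (1 - β) = β * -Real.log (1 - β) -
      (-Real.log (1 - β) - ∑ i ∈ Finset.range 1, β ^ (i + 1) / ((i : ℝ) + 1)) := by
    norm_num
    ring
  rw [hterm, hval]
  exact h3

/-- Summing the series gives `β² (X - 1) ≤ τ (1 - β) (β + log (1 - β))` for the avoidance factor `X`;
the normalization of the weights makes the terms without a factor `1 - β` cancel. -/
theorem sq_mul_avoidanceFactor_sub_one_le (d : ℕ) {β : ℝ} (hβ0 : 0 ≤ β) (hβ1 : β < 1) :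
    β ^ 2 * (avoidanceFactor d β - 1) ≤ 35 / 18 * ((1 - β) * (β + Real.log (1 - β))) := by
  have h := hasSum_pow_div_mul hβ0 hβ1
  have hle := sum_le_hasSum (Finset.Ico 0 (d - 1)) (fun n _ => by positivity) h
  have hsum : 1 / 2 * β ^ 2 + ∑ k ∈ Finset.Icc 3 d, β ^ k / ((k : ℝ) * ((k : ℝ) - 1)) ≤
      β + (1 - β) * Real.log (1 - β) := by
    rcases le_or_gt d 1 with hd | hd
    · rw [Finset.Icc_eq_empty (by omega), Finset.sum_empty, add_zero]
      have := sum_le_hasSum (Finset.range 1) (fun n _ => by positivity) h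
      norm_num at this
      linarith
    · refine le_trans (le_of_eq ?_) hle
      rw [Finset.sum_eq_sum_Ico_succ_bot (by omega)]
      have hIcc : Finset.Icc 3 d = Finset.Ico (0 + 1 + 2) (d - 1 + 2) := by
        ext
        simp only [Finset.mem_Icc, Finset.mem_Ico]
        omega
      rw [hIcc, ← Finset.sum_Ico_add' (fun k : ℕ => β ^ k / ((k : ℝ) * ((k : ℝ) - 1)))]
      congr 1
      · norm_num
        ring
      · refine Finset.sum_congr rfl fun n _ => ?_
        push_cast
        rw [show (n : ℝ) + 2 - 1 = n + 1 by ring]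
  have hX : β ^ 2 * avoidanceFactor d β = 1 / 36 * β ^ 2 +
      35 / 18 * ∑ k ∈ Finset.Icc 3 d, β ^ k / ((k : ℝ) * ((k : ℝ) - 1)) := by
    rw [avoidanceFactor, mul_add, Finset.mul_sum, Finset.mul_sum]
    congr 1
    · ring
    · refine Finset.sum_congr rfl fun k hk => ?_
      rw [Finset.mem_Icc] at hk
      obtain ⟨j, rfl⟩ := Nat.exists_eq_add_of_le' (by omega : 2 ≤ k)
      rw [Nat.add_sub_cancel, pow_add]
      ring
  rw [mul_sub, hX]
  nlinarith

/-- The base `e ^ τ * (17 / 12) τ` of the union bound over sparse violators. -/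
noncomputable def sparseBase : ℝ := Real.exp (35 / 18) * (595 / 216)

/-- The ratio of the geometric series that dominates the union bound over violators of density at
most `1 / 25`. -/
noncomputable def sparseRatio : ℝ := sparseBase * (1 / 25 : ℝ) ^ (17 / 18 : ℝ)

theorem sparseBase_pos : 0 < sparseBase := by unfold sparseBase; positivity

theorem sparseRatio_pos : 0 < sparseRatio := by
  have := sparseBase_pos
  unfold sparseRatio
  positivity

theorem sparseRatio_lt_one : sparseRatio < 1 := by
  have h : sparseRatio ^ 18 < 1 := by
    rw [sparseRatio, sparseBase, mul_pow, mul_pow, ← Real.exp_nat_mul, ← Real.rpow_natCast,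
      ← Real.rpow_natCast, ← Real.rpow_mul (by norm_num)]
    rw [show ((18 : ℕ) : ℝ) * (35 / 18) = (35 : ℕ) * 1 by norm_num, Real.exp_nat_mul,
      show (17 / 18 : ℝ) * ((18 : ℕ) : ℝ) = (17 : ℕ) by norm_num, Real.rpow_natCast,
      Real.rpow_natCast]
    have he : Real.exp 1 ^ 35 ≤ 2.7182818286 ^ 35 :=
      pow_le_pow_left₀ (Real.exp_pos _).le Real.exp_one_lt_d9.le _
    calc _ ≤ (2.7182818286 : ℝ) ^ 35 * (595 / 216) ^ 18 * (1 / 25) ^ 17 := by gcongr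
      _ < 1 := by norm_num
  by_contra hge
  exact absurd (one_le_pow₀ (not_lt.1 hge) : 1 ≤ sparseRatio ^ 18) (not_le.2 h)

theorem avoidance_pow_le_of_sparse {b s : ℕ} (hb : 1 ≤ b) (hs : 1 ≤ s) {β γ : ℝ}
    (hβ : β = b / (b + s : ℕ)) (hγ : γ = s / (b + s : ℕ)) (h : γ ≤ 1 / 25) :
    avoidanceFactor (b + s) β ^ b * (595 / 216 * γ / γ ^ 2) ^ s ≤
      sparseBase * (s * sparseRatio ^ (s - 1)) * ((b + s : ℕ) : ℝ) ^ (-(17 / 18) : ℝ) := by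
  have hd : (0 : ℝ) < (b + s : ℕ) := by exact_mod_cast (by omega : 0 < b + s)
  have hb' : (0 : ℝ) < b := by exact_mod_cast hb
  have hs' : (1 : ℝ) ≤ s := by exact_mod_cast hs
  have hβ0 : 0 < β := by rw [hβ]; positivity
  have hγ0 : 0 < γ := by rw [hγ]; positivity
  have hsum := density_add_eq_one hs hβ hγ
  have hX0 : 0 ≤ avoidanceFactor (b + s) β :=
    le_trans (by norm_num) (le_avoidanceFactor _ hβ0.le)
  have hkey := sq_mul_avoidanceFactor_sub_one_le (b + s) hβ0.le (by linarith : β < 1)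
  rw [show 1 - β = γ by linarith] at hkey
  set X := avoidanceFactor (b + s) β
  have hlog : Real.log γ ≤ 0 := Real.log_nonpos hγ0.le (by linarith)
  have hbX : b * (X - 1) ≤ s * (35 / 18 * (1 + Real.log γ)) := by
    have hbe : (b : ℝ) = β * (b + s : ℕ) := by rw [hβ]; field_simp
    have hse : (s : ℝ) = γ * (b + s : ℕ) := by rw [hγ]; field_simp
    have h1 : β * (X - 1) ≤ γ * (35 / 18 * (1 + Real.log γ)) := by
      have h2 : β * (β * (X - 1)) ≤ β * (γ * (35 / 18 * (1 + Real.log γ))) := by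
        have h3 : γ * Real.log γ ≤ β * (γ * Real.log γ) := by
          have := mul_nonpos_of_nonneg_of_nonpos hγ0.le hlog
          nlinarith
        nlinarith
      exact le_of_mul_le_mul_left h2 hβ0
    rw [hbe, hse]
    nlinarith
  have hXb : X ^ b ≤ Real.exp (35 / 18 * (1 + Real.log γ)) ^ s := by
    rw [← Real.exp_nat_mul]
    refine le_trans ?_ (Real.exp_le_exp.2 hbX)
    rw [Real.exp_nat_mul]
    refine pow_le_pow_left₀ hX0 ?_ _
    have := Real.add_one_le_exp (X - 1)
    linarith
  have hbase : Real.exp (35 / 18 * (1 + Real.log γ)) * (595 / 216 * γ / γ ^ 2) =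
      sparseBase * γ ^ (17 / 18 : ℝ) := by
    have h1 : 595 / 216 * γ / γ ^ 2 = 595 / 216 * Real.exp (-Real.log γ) := by
      rw [Real.exp_neg, Real.exp_log hγ0]
      field_simp
    rw [h1, Real.rpow_def_of_pos hγ0, sparseBase,
      show Real.exp (35 / 18 * (1 + Real.log γ)) * (595 / 216 * Real.exp (-Real.log γ)) =
        595 / 216 * (Real.exp (35 / 18 * (1 + Real.log γ)) * Real.exp (-Real.log γ)) by ring,
      show Real.exp (35 / 18) * (595 / 216) * Real.exp (Real.log γ * (17 / 18)) =
        595 / 216 * (Real.exp (35 / 18) * Real.exp (Real.log γ * (17 / 18))) by ring,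
      ← Real.exp_add, ← Real.exp_add]
    congr 2
    ring
  have hratio : sparseBase * γ ^ (17 / 18 : ℝ) ≤ sparseRatio := by
    unfold sparseRatio
    have := sparseBase_pos
    gcongr
  have hγd : γ ^ (17 / 18 : ℝ) ≤ s * ((b + s : ℕ) : ℝ) ^ (-(17 / 18) : ℝ) := by
    rw [hγ, Real.div_rpow (by positivity) hd.le, Real.rpow_neg hd.le, div_eq_mul_inv]
    have : (s : ℝ) ^ (17 / 18 : ℝ) ≤ s := by
      simpa using Real.rpow_le_rpow_of_exponent_le hs' (by norm_num : (17 / 18 : ℝ) ≤ 1)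
    gcongr
  have hB := sparseBase_pos
  have hR := sparseRatio_pos
  calc X ^ b * (595 / 216 * γ / γ ^ 2) ^ s
      ≤ Real.exp (35 / 18 * (1 + Real.log γ)) ^ s * (595 / 216 * γ / γ ^ 2) ^ s := by gcongr
    _ = (sparseBase * γ ^ (17 / 18 : ℝ)) ^ (s - 1) * (sparseBase * γ ^ (17 / 18 : ℝ)) := by
        rw [← mul_pow, hbase, pow_sub_one_mul (by omega)]
    _ ≤ sparseRatio ^ (s - 1) *
        (sparseBase * (s * ((b + s : ℕ) : ℝ) ^ (-(17 / 18) : ℝ))) := by gcongr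
    _ = _ := by ring

/-- Choosing the cut-off degree `K ≈ 3 / (2 γ)` in `neighbourhoodLaw_real_two_le`. -/
theorem exists_cutoff_le {γ : ℝ} (hγ0 : 0 < γ) (hγ : γ ≤ 1 / 25) : ∃ K : ℕ, 2 ≤ K ∧
    (1 / 36 + ((K : ℝ) - 2) * (35 / 36)) * γ ^ 2 + 35 / 18 / K ≤ 595 / 216 * γ := by
  have hpos : (0 : ℝ) < 3 / (2 * γ) := by positivity
  have h1 := Nat.le_ceil (3 / (2 * γ))
  have h2 := Nat.ceil_lt_add_one hpos.le
  set K := ⌈3 / (2 * γ)⌉₊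
  have hbig : 2 ≤ 3 / (2 * γ) := by
    rw [le_div_iff₀ (by positivity)]
    linarith
  refine ⟨K, by exact_mod_cast hbig.trans h1, ?_⟩
  have hK : (0 : ℝ) < K := hpos.trans_le h1
  have h3 : 35 / 18 / (K : ℝ) ≤ 35 / 27 * γ := by
    rw [div_le_iff₀ (by positivity)] at h1 ⊢
    linarith
  have h4 : (K : ℝ) * γ ≤ 3 / 2 + γ := by
    have := mul_le_mul_of_nonneg_right h2.le hγ0.le
    rw [add_mul, one_mul, div_mul_eq_mul_div, mul_comm (2 : ℝ), ← div_div,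
      mul_div_cancel_right₀ _ hγ0.ne'] at this
    exact this
  nlinarith [mul_le_mul_of_nonneg_right h4 hγ0.le, sq_nonneg γ]

/-! ### Summing the union bound -/

/-- Every violator size is sparse, intermediate, or almost everything, so its term in the union
bound is at most one of the three summands. -/
theorem exists_union_bound_term_le {b s : ℕ} (hb : 1 ≤ b) (hs : 1 ≤ s) (hd : 2 ≤ b + s) :
    ∃ r : ℝ, (∀ A : Finset (Fin (b + s)), A.card = s →
      (SparseCode.neighbourhoodLaw (b + s) (SparseCode.waveSoliton (b + s) hd)).toMeasure.real
        {N | 2 ≤ (N ∩ A).card} ≤ r) ∧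
      ((b + s).choose s : ℝ) * (b + s).choose (s - 1) *
        (35 / 18 / (b + s : ℕ) * ((b : ℝ) / (b + s : ℕ)) + ((b : ℝ) / (b + s : ℕ)) ^ 2 *
          avoidanceFactor (b + s) (b / (b + s : ℕ))) ^ (b + 1) * r ^ (s - 1) ≤
      Real.exp 140 * (sparseBase * (s * sparseRatio ^ (s - 1)) *
        ((b + s : ℕ) : ℝ) ^ (-(17 / 18) : ℝ) + b * (4 / 5) ^ b / (b + s : ℕ) +
          18 * Real.exp (-(1 / 250) * (b + s : ℕ))) := by
  have hd0 : (0 : ℝ) < (b + s : ℕ) := by exact_mod_cast (by omega : 0 < b + s)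
  have hb' : (0 : ℝ) < b := by exact_mod_cast hb
  have hs' : (0 : ℝ) < s := by exact_mod_cast hs
  obtain ⟨β, hβ⟩ : ∃ β : ℝ, β = b / (b + s : ℕ) := ⟨_, rfl⟩
  obtain ⟨γ, hγ⟩ : ∃ γ : ℝ, γ = s / (b + s : ℕ) := ⟨_, rfl⟩
  have hβ0 : 0 < β := by rw [hβ]; positivity
  have hγ0 : 0 < γ := by rw [hγ]; positivity
  have hsum := density_add_eq_one hs hβ hγ
  have hX0 : 0 ≤ avoidanceFactor (b + s) β :=
    le_trans (by norm_num) (le_avoidanceFactor _ hβ0.le)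
  have hβγ : β * γ ≤ 1 := mul_le_one₀ (by linarith) hγ0.le (by linarith)
  have hB := sparseBase_pos
  have hR := sparseRatio_pos
  have e1 : 0 ≤ sparseBase * (s * sparseRatio ^ (s - 1)) *
      ((b + s : ℕ) : ℝ) ^ (-(17 / 18) : ℝ) := by positivity
  have e2 : (0 : ℝ) ≤ b * (4 / 5) ^ b / (b + s : ℕ) := by positivity
  have e3 : (0 : ℝ) ≤ 18 * Real.exp (-(1 / 250) * (b + s : ℕ)) := by positivity
  rw [← hβ]
  have hone : ∀ A : Finset (Fin (b + s)),
      (SparseCode.neighbourhoodLaw (b + s) (SparseCode.waveSoliton (b + s) hd)).toMeasure.real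
        {N | 2 ≤ (N ∩ A).card} ≤ 1 := fun A => measureReal_le_one
  have htwo : ∀ (K : ℕ), 2 ≤ K → ∀ A : Finset (Fin (b + s)), A.card = s →
      (SparseCode.neighbourhoodLaw (b + s) (SparseCode.waveSoliton (b + s) hd)).toMeasure.real
        {N | 2 ≤ (N ∩ A).card} ≤
          (1 / 36 + ((K : ℝ) - 2) * (35 / 36)) * γ ^ 2 + 35 / 18 / K := by
    intro K hK A hA
    have := neighbourhoodLaw_real_two_le hd A hK
    rwa [hA, ← hγ] at this
  rcases le_or_gt γ (1 / 25) with hsparse | hsparse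
  · obtain ⟨K, hK, hKγ⟩ := exists_cutoff_le hγ0 hsparse
    refine ⟨595 / 216 * γ, fun A hA => (htwo K hK A hA).trans hKγ, ?_⟩
    refine (union_bound_term_le hb hs (by positivity) le_rfl (by positivity) hβ hγ).trans ?_
    refine mul_le_mul_of_nonneg_left ?_ (Real.exp_pos _).le
    have h1 := avoidance_pow_le_of_sparse hb hs hβ hγ hsparse
    have h2 : β * γ / (595 / 216 * γ) ≤ 1 := by
      rw [div_le_one (by positivity)]
      nlinarith
    have h3 := mul_le_of_le_one_right (by positivity :
      0 ≤ avoidanceFactor (b + s) β ^ b * (595 / 216 * γ / γ ^ 2) ^ s) h2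
    linarith
  rcases le_or_gt β (1 / 5) with hsmall | hsmall
  · refine ⟨1, fun A _ => hone A, ?_⟩
    refine (union_bound_term_le hb hs zero_le_one le_rfl one_pos hβ hγ).trans ?_
    refine mul_le_mul_of_nonneg_left ?_ (Real.exp_pos _).le
    have h1 := avoidance_pow_le_of_le_fifth hs hβ hγ hsmall
    have h2 : β * γ / 1 ≤ β := by
      rw [div_one]
      exact mul_le_of_le_one_right hβ0.le (by linarith)
    have h3 := mul_le_mul h1 h2 (by positivity) (by positivity)
    have h4 : (4 / 5) ^ b * β = b * (4 / 5) ^ b / (b + s : ℕ) := by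
      rw [hβ]
      ring
    rw [h4] at h3
    linarith
  · obtain ⟨c, e, hc, he, hce, hle⟩ :=
      exists_two_bound_of_intermediate hs hβ hγ hsmall.le (by linarith)
    have hr0 : 1 / 18 ≤ c * γ ^ 2 + e := by
      have : 0 ≤ c * γ ^ 2 := by positivity
      linarith
    refine ⟨c * γ ^ 2 + e, fun A hA => ?_, ?_⟩
    · rcases hce with ⟨rfl, rfl⟩ | ⟨K, hK, rfl, rfl⟩
      · simp
      · exact htwo K hK A hA
    refine (union_bound_term_le hb hs (by linarith) le_rfl (by linarith) hβ hγ).trans ?_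
    refine mul_le_mul_of_nonneg_left ?_ (Real.exp_pos _).le
    have h2 : β * γ / (c * γ ^ 2 + e) ≤ 18 := by
      rw [div_le_iff₀ (by linarith)]
      linarith
    have h3 := mul_le_mul hle h2 (by positivity) (Real.exp_pos _).le
    linarith

theorem exists_sum_mul_pow_le {ρ : ℝ} (h0 : 0 ≤ ρ) (h1 : ρ < 1) :
    ∃ C : ℝ, 0 ≤ C ∧ ∀ t : Finset ℕ, ∑ n ∈ t, (n : ℝ) * ρ ^ n ≤ C := by
  have h := hasSum_coe_mul_geometric_of_norm_lt_one (r := ρ)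
    (by rw [Real.norm_of_nonneg h0]; exact h1)
  exact ⟨_, h.nonneg fun n => by positivity, fun t => sum_le_hasSum t (fun n _ => by positivity) h⟩

/-- The random bipartite graph fails to have a system of distinct representatives with probability
`O(d ^ (-17/18))`, the order of the expected number of isolated vertices of `V₁`. -/
theorem exists_no_matching_real_le : ∃ C : ℝ, 0 ≤ C ∧ ∀ (d : ℕ) (hd : 2 ≤ d),
    (SparseCode.randomNeighbourhoods d (SparseCode.waveSoliton d hd)).real
      {N | ¬ ∃ f : Fin d → Fin d, Function.Injective f ∧ ∀ u, u ∈ N (f u)} ≤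
        C * (d : ℝ) ^ (-(17 / 18) : ℝ) := by
  obtain ⟨C₁, hC₁, h₁⟩ := exists_sum_mul_pow_le sparseRatio_pos.le sparseRatio_lt_one
  obtain ⟨C₂, hC₂, h₂⟩ := exists_sum_mul_pow_le (by norm_num : (0 : ℝ) ≤ 4 / 5) (by norm_num)
  have hB := sparseBase_pos
  have hR := sparseRatio_pos
  refine ⟨Real.exp 140 * (sparseBase * (C₁ / sparseRatio) + C₂ + 18 * 125000), by positivity,
    fun d hd => ?_⟩
  have hd0 : (0 : ℝ) < d := by exact_mod_cast (by omega : 0 < d)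
  have hd1 : (1 : ℝ) ≤ d := by exact_mod_cast (by omega : 1 ≤ d)
  let q : ℕ → ℝ := fun s => 35 / 18 / d * (((d - s : ℕ) : ℝ) / d) +
    (((d - s : ℕ) : ℝ) / d) ^ 2 * avoidanceFactor d ((d - s : ℕ) / d)
  let bound : ℕ → ℝ := fun s => Real.exp 140 * (sparseBase * (s * sparseRatio ^ (s - 1)) *
    (d : ℝ) ^ (-(17 / 18) : ℝ) + (d - s : ℕ) * (4 / 5) ^ (d - s) / d +
      18 * Real.exp (-(1 / 250) * d))
  have hbound0 : ∀ s, 0 ≤ bound s := fun s => by positivity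
  have hterm : ∀ s : ℕ, ∃ r : ℝ, 1 ≤ s → s ≤ d →
      (∀ A : Finset (Fin d), A.card = s →
        (SparseCode.neighbourhoodLaw d (SparseCode.waveSoliton d hd)).toMeasure.real
          {N | 2 ≤ (N ∩ A).card} ≤ r) ∧
      (d.choose s : ℝ) * d.choose (s - 1) * q s ^ (d - s + 1) * r ^ (s - 1) ≤ bound s := by
    intro s
    rcases Nat.lt_or_ge s 1 with hs | hs
    · exact ⟨0, fun h => absurd h (by omega)⟩
    rcases Nat.lt_or_ge s d with hsd | hsd
    · obtain ⟨b, rfl⟩ := Nat.exists_eq_add_of_le' hsd.le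
      obtain ⟨r, hr1, hr2⟩ := exists_union_bound_term_le (by omega : 1 ≤ b) hs hd
      refine ⟨r, fun _ _ => ⟨hr1, ?_⟩⟩
      simp only [q, bound, Nat.add_sub_cancel]
      exact hr2
    · refine ⟨1, fun _ hle => ⟨fun A _ => measureReal_le_one, ?_⟩⟩
      obtain rfl : s = d := by omega
      -- No vertex of `V₂` is isolated, so `V₁` itself is never avoided.
      have hq : q s = 0 := by simp [q]
      rw [hq, zero_pow (by omega), mul_zero, zero_mul]
      exact hbound0 s
  choose r hr using hterm
  have hq : ∀ A : Finset (Fin d), A.Nonempty →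
      (SparseCode.neighbourhoodLaw d (SparseCode.waveSoliton d hd)).toMeasure.real
        {N | Disjoint N A} ≤ q A.card := by
    intro A _
    have hA : A.card ≤ d := by simpa using A.card_le_univ
    exact neighbourhoodLaw_real_disjoint_le hd A _ (by omega)
  have hr' : ∀ A : Finset (Fin d), A.Nonempty →
      (SparseCode.neighbourhoodLaw d (SparseCode.waveSoliton d hd)).toMeasure.real
        {N | 2 ≤ (N ∩ A).card} ≤ r A.card := by
    intro A hne
    have hA : A.card ≤ d := by simpa using A.card_le_univ
    exact (hr A.card hne.card_pos hA).1 A rfl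
  refine (randomNeighbourhoods_real_no_matching_le _ hq hr').trans ?_
  have hsum : ∑ s ∈ Finset.Icc 1 d, (d.choose s : ℝ) * d.choose (s - 1) * q s ^ (d - s + 1) *
      r s ^ (s - 1) ≤ ∑ s ∈ Finset.Icc 1 d, bound s :=
    Finset.sum_le_sum fun s hs => by
      rw [Finset.mem_Icc] at hs
      exact (hr s hs.1 hs.2).2
  refine hsum.trans ?_
  simp only [bound]
  rw [← Finset.mul_sum, Finset.sum_add_distrib, Finset.sum_add_distrib, ← Finset.sum_mul,
    ← Finset.mul_sum, ← Finset.sum_div, Finset.sum_const, Nat.card_Icc, nsmul_eq_mul,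
    mul_assoc (Real.exp 140)]
  refine mul_le_mul_of_nonneg_left ?_ (Real.exp_pos _).le
  have hinv : (1 : ℝ) / d ≤ (d : ℝ) ^ (-(17 / 18) : ℝ) := by
    rw [one_div, ← Real.rpow_neg_one]
    exact Real.rpow_le_rpow_of_exponent_le hd1 (by norm_num)
  set D := (d : ℝ) ^ (-(17 / 18) : ℝ) with hD
  have hD0 : 0 ≤ D := by positivity
  have s1 : ∑ s ∈ Finset.Icc 1 d, (s : ℝ) * sparseRatio ^ (s - 1) ≤ C₁ / sparseRatio := by
    rw [le_div_iff₀ hR, Finset.sum_mul]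
    refine le_trans (le_of_eq (Finset.sum_congr rfl fun s hs => ?_)) (h₁ (Finset.Icc 1 d))
    rw [Finset.mem_Icc] at hs
    rw [mul_assoc, pow_sub_one_mul (by omega)]
  have s2 : ∑ s ∈ Finset.Icc 1 d, ((d - s : ℕ) : ℝ) * (4 / 5) ^ (d - s) ≤ C₂ := by
    rw [← Finset.sum_image (f := fun b : ℕ => (b : ℝ) * (4 / 5) ^ b) (g := fun s => d - s)]
    · exact h₂ _
    · intro x hx y hy hxy
      simp only [Finset.coe_Icc, Set.mem_Icc] at hx hy hxy
      omega
  have s3 : (d : ℝ) * Real.exp (-(1 / 250) * d) ≤ 125000 * (1 / d) := by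
    have h := Real.quadratic_le_exp_of_nonneg (by positivity : (0 : ℝ) ≤ 1 / 250 * d)
    rw [neg_mul, Real.exp_neg, ← div_eq_mul_inv, div_le_iff₀ (Real.exp_pos _), mul_one_div,
      div_mul_eq_mul_div, le_div_iff₀ hd0]
    nlinarith
  have t1 := mul_le_mul_of_nonneg_right (mul_le_mul_of_nonneg_left s1 hB.le) hD0
  have t2 : (∑ s ∈ Finset.Icc 1 d, ((d - s : ℕ) : ℝ) * (4 / 5) ^ (d - s)) / d ≤ C₂ * D := by
    rw [div_eq_mul_one_div]
    exact mul_le_mul s2 hinv (by positivity) hC₂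
  have t3 : ((d + 1 - 1 : ℕ) : ℝ) * (18 * Real.exp (-(1 / 250) * d)) ≤ 18 * 125000 * D := by
    rw [Nat.add_sub_cancel]
    linarith
  linarith

/-! ### Full rank -/

theorem exists_equiv_of_injective_mem {d : ℕ} {N : Fin d → Finset (Fin d)}
    (h : ∃ f : Fin d → Fin d, Function.Injective f ∧ ∀ u, u ∈ N (f u)) :
    ∃ σ : Equiv.Perm (Fin d), ∀ u, u ∈ N (σ u) := by
  obtain ⟨f, hf, hN⟩ := h
  exact ⟨Equiv.ofBijective f (Finite.injective_iff_bijective.1 hf), hN⟩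

/-- Singularity comes either from the graph or, by Schwartz–Zippel, from the edge values. -/
theorem randomCoefficients_real_rank_ne_le {d : ℕ} (P : PMF (Fin (d + 1))) {S : Finset ℝ}
    (hS : S.Nonempty) :
    (SparseCode.randomCoefficients d P S).real
      {ω | (SparseCode.coefficientMatrix ω.1 ω.2).rank ≠ d} ≤
      (SparseCode.randomNeighbourhoods d P).real
        {N | ¬ ∃ f : Fin d → Fin d, Function.Injective f ∧ ∀ u, u ∈ N (f u)} + d / S.card := by
  classical
  have hS' : (S : Set ℝ).Nonempty := hS
  have : IsProbabilityMeasure (uniformOn (S : Set ℝ)) :=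
    isProbabilityMeasure_uniformOn S.finite_toSet hS'
  have hμ : IsProbabilityMeasure (SparseCode.randomNeighbourhoods d P) := by
    unfold SparseCode.randomNeighbourhoods
    infer_instance
  set μ := SparseCode.randomNeighbourhoods d P
  set ν := Measure.pi fun _ : Fin d × Fin d => uniformOn (S : Set ℝ) with hν
  let bad : Set (Fin d → Finset (Fin d)) :=
    {N | ¬ ∃ f : Fin d → Fin d, Function.Injective f ∧ ∀ u, u ∈ N (f u)}
  let good : Finset (Fin d → Finset (Fin d)) :=
    Finset.univ.filter fun N => ∃ f : Fin d → Fin d, Function.Injective f ∧ ∀ u, u ∈ N (f u)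
  let T : (Fin d → Finset (Fin d)) → Set (Fin d × Fin d → ℝ) := fun N =>
    {x | (SparseCode.coefficientMatrix N x).rank ≠ d}
  have hT : ∀ N ∈ good, ν.real (T N) ≤ d / S.card := by
    intro N hN
    obtain ⟨σ, hσ⟩ := exists_equiv_of_injective_mem (Finset.mem_filter.1 hN).2
    exact pi_uniformOn_real_rank_ne_le N σ hσ hS
  calc (μ.prod ν).real {ω | (SparseCode.coefficientMatrix ω.1 ω.2).rank ≠ d}
      ≤ (μ.prod ν).real (bad ×ˢ Set.univ ∪ ⋃ N ∈ good, {N} ×ˢ T N) := by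
        refine measureReal_mono fun ω hω => ?_
        by_cases hb : ω.1 ∈ bad
        · exact Or.inl ⟨hb, trivial⟩
        · refine Or.inr (Set.mem_biUnion (x := ω.1) ?_ ⟨rfl, hω⟩)
          simpa [good, bad] using hb
    _ ≤ (μ.prod ν).real (bad ×ˢ Set.univ) + ∑ N ∈ good, (μ.prod ν).real ({N} ×ˢ T N) :=
        (measureReal_union_le _ _).trans
          (add_le_add le_rfl (measureReal_biUnion_finset_le _ _))
    _ = μ.real bad + ∑ N ∈ good, μ.real {N} * ν.real (T N) := by
        simp only [measureReal_prod_prod, probReal_univ, mul_one]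
    _ ≤ μ.real bad + ∑ N ∈ good, μ.real {N} * (d / S.card) := by
        gcongr with N hN
        exact hT N hN
    _ ≤ μ.real bad + 1 * (d / S.card) := by
        rw [← Finset.sum_mul, sum_measureReal_singleton]
        gcongr
        exact measureReal_le_one
    _ = _ := by rw [one_mul]

/-- A lower bound on the probability of an event without measurability. -/
theorem one_sub_le_measureReal {Ω : Type*} [MeasurableSpace Ω] {μ : Measure Ω}
    [IsProbabilityMeasure μ] {E F : Set Ω} {p : ℝ} (hEF : Eᶜ ⊆ F) (hF : μ.real F ≤ p) :
    1 - p ≤ μ.real E := by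
  have h1 := measureReal_union_le (μ := μ) E Eᶜ
  rw [Set.union_compl_self, probReal_univ] at h1
  have h2 := measureReal_mono (μ := μ) hEF
  linarith

theorem theorem2 :
    ∃ c : ℝ, 0 < c ∧ ∀ (m n : ℕ) (hmn : 2 ≤ m * n),
      (1 - c * ((m * n : ℕ) : ℝ) ^ (-0.94 : ℝ) <
        (SparseCode.randomNeighbourhoods (m * n) (SparseCode.waveSoliton (m * n) hmn)).real
          {N | ∃ M : (SparseCode.bipartiteGraph N).Subgraph, M.IsPerfectMatching}) ∧
      ∀ S : Finset ℝ, S.card = (m * n) ^ 2 →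
        1 - c * ((m * n : ℕ) : ℝ) ^ (-0.94 : ℝ) <
          (SparseCode.randomCoefficients (m * n) (SparseCode.waveSoliton (m * n) hmn) S).real
            {ω | (SparseCode.coefficientMatrix ω.1 ω.2).rank = m * n} := by
  obtain ⟨C, hC, h⟩ := exists_no_matching_real_le
  refine ⟨C + 2, by positivity, fun m n hmn => ?_⟩
  have hP := h (m * n) hmn
  generalize m * n = d at hmn hP ⊢
  have hd1 : (1 : ℝ) ≤ d := by exact_mod_cast (by omega : 1 ≤ d)
  have hd0 : (0 : ℝ) < d := by linarith
  have hμ : IsProbabilityMeasure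
      (SparseCode.randomNeighbourhoods d (SparseCode.waveSoliton d hmn)) := by
    unfold SparseCode.randomNeighbourhoods
    infer_instance
  have hpow : (d : ℝ) ^ (-(17 / 18) : ℝ) ≤ (d : ℝ) ^ (-0.94 : ℝ) :=
    Real.rpow_le_rpow_of_exponent_le hd1 (by norm_num)
  have hinv : (1 : ℝ) / d ≤ (d : ℝ) ^ (-0.94 : ℝ) := by
    rw [one_div, ← Real.rpow_neg_one]
    exact Real.rpow_le_rpow_of_exponent_le hd1 (by norm_num)
  have hpos : 0 < (d : ℝ) ^ (-0.94 : ℝ) := Real.rpow_pos_of_pos hd0 _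
  have hP' := hP.trans (mul_le_mul_of_nonneg_left hpow hC)
  refine ⟨?_, fun S hS => ?_⟩
  · refine lt_of_lt_of_le (b := 1 - C * (d : ℝ) ^ (-0.94 : ℝ)) (by linarith)
      (one_sub_le_measureReal (fun N hN => ?_) hP')
    rintro ⟨f, hf, hfN⟩
    exact hN (bipartiteGraph_exists_isPerfectMatching N (Finite.injective_iff_bijective.1 hf) hfN)
  · have hSne : S.Nonempty := Finset.card_pos.1 (by rw [hS]; positivity)
    have : IsProbabilityMeasure (uniformOn (S : Set ℝ)) :=
      isProbabilityMeasure_uniformOn S.finite_toSet hSne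
    have : IsProbabilityMeasure
        (SparseCode.randomCoefficients d (SparseCode.waveSoliton d hmn) S) := by
      unfold SparseCode.randomCoefficients
      infer_instance
    have hdS : (d : ℝ) / S.card = 1 / d := by
      rw [hS]
      push_cast
      field_simp
    have hR := randomCoefficients_real_rank_ne_le (SparseCode.waveSoliton d hmn) hSne
    rw [hdS] at hR
    refine lt_of_lt_of_le (b := 1 - (C + 1) * (d : ℝ) ^ (-0.94 : ℝ)) (by linarith)
      (one_sub_le_measureReal (fun _ hω => hω) (hR.trans ?_))
    linarith
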